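/- Let $a>0$ and $c_-,c_+\in\mathbb C$. Let $H$ be the operator in $L^2(-a,a)$ (inner product antilinear in the first argument) with domain $\{\psi\in W^{2,2}(-a,a):\ \psi'(a)+c_+\psi(a)=0,\ \psi'(-a)+c_-\psi(-a)=0\}$ and $H\psi=-\psi''$. Assume that all eigenvalues of $H$ are simple, i.e. have algebraic multiplicity one. Let $(\lambda_n)_{n\ge 0}$ be an enumeration of the eigenvalues, without repetition, such that $|\lambda_n|$ is nondecreasing from some index on. For each $n$ let $\phi_n\neq 0$ be an eigenfunction of $H^*$, $H^*\phi_n=\overline{\lambda_n}\,\phi_n$, normalized for all but finitely many $n$ by $\phi_n(-a)=1/\sqrt a$, that is, by $$\phi_n(x)=\frac1{\sqrt a}\Big(\cos(\overline{l_n}(x+a))-\frac{\overline{c_-}}{\overline{l_n}}\sin(\overline{l_n}(x+a))\Big),\qquad l_n^2=\lambda_n$$ (the quotient $\sin(\overline{l_n}(x+a))/\overline{l_n}$ meaning $x+a$ if $l_n=0$). Let $(e_n)_{n\ge 0}$ be any orthonormal basis of $L^2(-a,a)$, and let $\chi_0^N=1/\sqrt{2a}$ and $\chi_n^N(x)=\frac1{\sqrt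 a}\cos\big(\frac{n\pi}{2a}(x+a)\big)$ for $n\ge1$. Then the series $$\Omega:=\sum_{n=0}^\infty e_n\langle\phi_n,\cdot\rangle,\qquad U:=\sum_{n=0}^\infty e_n\langle\chi_n^N,\cdot\rangle$$ converge strongly to bounded operators on $L^2(-a,a)$, $U$ is unitary with $U\chi_n^N=e_n$ for all $n$, and $\Omega=U+L$ with a Hilbert–Schmidt operator $L$. -/

import Mathlib

open MeasureTheory Set Filter
open scoped ContDiff ComplexConjugate

noncomputable section

namespace RobinInterval

/-- The Hilbert space `L²(-a,a)`; `inner ℂ` is antilinear in its first argument. -/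
abbrev L2 (a : ℝ) : Type := Lp ℂ 2 (volume.restrict (Ioo (-a) a))

/-- `g` is the weak derivative of `ψ` on `(-a,a)`, tested against `C_c^∞(-a,a)`. -/
def HasWeakDeriv (a : ℝ) (ψ g : L2 a) : Prop :=
  ∀ η : ℝ → ℝ, ContDiff ℝ ∞ η → HasCompactSupport η → tsupport η ⊆ Ioo (-a) a →
    ∫ x in Ioo (-a) a, deriv η x • ψ x = - ∫ x in Ioo (-a) a, η x • g x

/-- `u` is the continuous representative on `[-a,a]` of the class `ψ`. -/
def IsContRep (a : ℝ) (ψ : L2 a) (u : ℝ → ℂ) : Prop :=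
  ContinuousOn u (Icc (-a) a) ∧ ψ =ᵐ[volume.restrict (Ioo (-a) a)] u

/-- `ψ ∈ W^{2,2}(-a,a)` with first and second weak derivatives `ψ₁`, `ψ₂`. -/
def HasTwoWeakDerivs (a : ℝ) (ψ ψ₁ ψ₂ : L2 a) : Prop :=
  HasWeakDeriv a ψ ψ₁ ∧ HasWeakDeriv a ψ₁ ψ₂

/-- The Robin boundary conditions `ψ'(a) + c₊ ψ(a) = 0` and `ψ'(-a) + c₋ ψ(-a) = 0`, read on the
continuous representatives of `ψ` and of its derivative `ψ₁`. -/
def RobinBC (a : ℝ) (cm cp : ℂ) (ψ ψ₁ : L2 a) : Prop :=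
  ∃ u v : ℝ → ℂ, IsContRep a ψ u ∧ IsContRep a ψ₁ v ∧
    v a + cp * u a = 0 ∧ v (-a) + cm * u (-a) = 0

lemma integrable_test {a : ℝ} (ψ : L2 a) {η : ℝ → ℝ} (hη : Continuous η)
    (hc : HasCompactSupport η) :
    Integrable (fun x => η x • ψ x) (volume.restrict (Ioo (-a) a)) := by
  have h1 : Integrable ψ (volume.restrict (Ioo (-a) a)) :=
    (Lp.memLp ψ).integrable (by norm_num)
  obtain ⟨C, hC⟩ := hη.bounded_above_of_compact_support hc
  exact h1.bdd_smul C hη.aestronglyMeasurable (Eventually.of_forall hC)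

lemma HasWeakDeriv.add {a : ℝ} {ψ g ψ' g' : L2 a} (h : HasWeakDeriv a ψ g)
    (h' : HasWeakDeriv a ψ' g') : HasWeakDeriv a (ψ + ψ') (g + g') := by
  intro η h1 h2 h3
  have hd : Continuous (deriv η) := h1.continuous_deriv (by simp)
  have e1 : ∫ x in Ioo (-a) a, deriv η x • (ψ + ψ' : L2 a) x
      = ∫ x in Ioo (-a) a, (deriv η x • ψ x + deriv η x • ψ' x) := by
    apply integral_congr_ae
    filter_upwards [Lp.coeFn_add ψ ψ'] with x hx
    rw [hx, Pi.add_apply, smul_add]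
  have e2 : ∫ x in Ioo (-a) a, η x • (g + g' : L2 a) x
      = ∫ x in Ioo (-a) a, (η x • g x + η x • g' x) := by
    apply integral_congr_ae
    filter_upwards [Lp.coeFn_add g g'] with x hx
    rw [hx, Pi.add_apply, smul_add]
  rw [e1, e2, integral_add (integrable_test ψ hd h2.deriv) (integrable_test ψ' hd h2.deriv),
    integral_add (integrable_test g h1.continuous h2) (integrable_test g' h1.continuous h2),
    h η h1 h2 h3, h' η h1 h2 h3, neg_add]

lemma HasWeakDeriv.smul {a : ℝ} {ψ g : L2 a} (c : ℂ) (h : HasWeakDeriv a ψ g) :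
    HasWeakDeriv a (c • ψ) (c • g) := by
  intro η h1 h2 h3
  have e1 : ∫ x in Ioo (-a) a, deriv η x • (c • ψ : L2 a) x
      = ∫ x in Ioo (-a) a, c • (deriv η x • ψ x) := by
    apply integral_congr_ae
    filter_upwards [Lp.coeFn_smul c ψ] with x hx
    rw [hx, Pi.smul_apply, smul_comm]
  have e2 : ∫ x in Ioo (-a) a, η x • (c • g : L2 a) x
      = ∫ x in Ioo (-a) a, c • (η x • g x) := by
    apply integral_congr_ae
    filter_upwards [Lp.coeFn_smul c g] with x hx
    rw [hx, Pi.smul_apply, smul_comm]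
  rw [e1, e2, integral_smul, integral_smul, h η h1 h2 h3, smul_neg]

lemma HasWeakDeriv.unique {a : ℝ} {ψ g g' : L2 a} (h : HasWeakDeriv a ψ g)
    (h' : HasWeakDeriv a ψ g') : g = g' := by
  have hi : ∀ f : L2 a, IntegrableOn f (Ioo (-a) a) := fun f =>
    (Lp.memLp f).integrable (by norm_num)
  have key := (isOpen_Ioo (a := -a) (b := a)).ae_eq_zero_of_integral_contDiff_smul_eq_zero
    (f := fun x => g x - g' x) (μ := volume)
    (((hi g).sub (hi g')).locallyIntegrableOn) (by
      intro η h1 h2 h3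
      have hz : ∀ x, x ∉ Ioo (-a) a → η x • (g x - g' x) = 0 := by
        intro x hx
        rw [image_eq_zero_of_notMem_tsupport (fun hx' => hx (h3 hx')), zero_smul]
      rw [← setIntegral_eq_integral_of_forall_compl_eq_zero hz]
      simp only [smul_sub]
      rw [integral_sub (integrable_test g h1.continuous h2)
        (integrable_test g' h1.continuous h2)]
      have := (h η h1 h2 h3).symm.trans (h' η h1 h2 h3)
      rw [neg_inj.mp this, sub_self])
  apply Lp.ext
  rw [Filter.EventuallyEq, ae_restrict_iff' measurableSet_Ioo]
  filter_upwards [key] with x hx hx'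
  exact sub_eq_zero.mp (hx hx')

lemma IsContRep.add {a : ℝ} {ψ ψ' : L2 a} {u u' : ℝ → ℂ} (h : IsContRep a ψ u)
    (h' : IsContRep a ψ' u') : IsContRep a (ψ + ψ') (u + u') :=
  ⟨h.1.add h'.1, (Lp.coeFn_add ψ ψ').trans (h.2.add h'.2)⟩

lemma IsContRep.smul {a : ℝ} {ψ : L2 a} {u : ℝ → ℂ} (c : ℂ) (h : IsContRep a ψ u) :
    IsContRep a (c • ψ) (c • u) :=
  ⟨h.1.const_smul c, (Lp.coeFn_smul c ψ).trans (h.2.const_smul c)⟩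

/-- The domain of the Robin operator: `ψ ∈ W^{2,2}(-a,a)` with `ψ'(±a) + c_± ψ(±a) = 0`. -/
def robinDomain (a : ℝ) (cm cp : ℂ) : Submodule ℂ (L2 a) where
  carrier := {ψ | ∃ ψ₁ ψ₂ : L2 a, HasTwoWeakDerivs a ψ ψ₁ ψ₂ ∧ RobinBC a cm cp ψ ψ₁}
  zero_mem' := by
    have h0 : HasWeakDeriv a 0 0 := by
      intro η _ _ _
      have e : ∀ f : ℝ → ℝ, ∫ x in Ioo (-a) a, f x • (0 : L2 a) x = 0 := by
        intro f
        rw [integral_eq_zero_of_ae]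
        filter_upwards [Lp.coeFn_zero ℂ 2 (volume.restrict (Ioo (-a) a))] with x hx
        exact (congrArg (f x • ·) hx).trans (smul_zero _)
      rw [e, e, neg_zero]
    have hr : IsContRep a 0 0 := ⟨continuousOn_const, Lp.coeFn_zero ℂ 2 _⟩
    exact ⟨0, 0, ⟨h0, h0⟩, 0, 0, hr, hr, by simp, by simp⟩
  add_mem' := by
    rintro ψ φ ⟨ψ₁, ψ₂, ⟨h1, h2⟩, u, v, hu, hv, hp, hm⟩ ⟨φ₁, φ₂, ⟨k1, k2⟩, w, z, hw, hz, jp, jm⟩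
    refine ⟨ψ₁ + φ₁, ψ₂ + φ₂, ⟨h1.add k1, h2.add k2⟩, u + w, v + z, hu.add hw, hv.add hz, ?_, ?_⟩
    · simp only [Pi.add_apply]; linear_combination hp + jp
    · simp only [Pi.add_apply]; linear_combination hm + jm
  smul_mem' := by
    rintro c ψ ⟨ψ₁, ψ₂, ⟨h1, h2⟩, u, v, hu, hv, hp, hm⟩
    refine ⟨c • ψ₁, c • ψ₂, ⟨h1.smul c, h2.smul c⟩, c • u, c • v, hu.smul c, hv.smul c, ?_, ?_⟩
    · simp only [Pi.smul_apply, smul_eq_mul]; linear_combination c * hp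
    · simp only [Pi.smul_apply, smul_eq_mul]; linear_combination c * hm

lemma exists_second_weakDeriv {a : ℝ} {cm cp : ℂ} (ψ : robinDomain a cm cp) :
    ∃ ψ₂ : L2 a, ∃ ψ₁ : L2 a, HasTwoWeakDerivs a ψ ψ₁ ψ₂ := by
  obtain ⟨_, ψ₁, ψ₂, h, _⟩ := ψ
  exact ⟨ψ₂, ψ₁, h⟩

lemma HasTwoWeakDerivs.unique {a : ℝ} {ψ ψ₁ ψ₂ φ₁ φ₂ : L2 a} (h : HasTwoWeakDerivs a ψ ψ₁ ψ₂)
    (h' : HasTwoWeakDerivs a ψ φ₁ φ₂) : ψ₂ = φ₂ := by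
  obtain rfl := h.1.unique h'.1
  exact h.2.unique h'.2

/-- The Robin operator `H ψ = -ψ''` in `L²(-a,a)`. -/
def robin (a : ℝ) (cm cp : ℂ) : L2 a →ₗ.[ℂ] L2 a where
  domain := robinDomain a cm cp
  toFun :=
    { toFun := fun ψ => -(exists_second_weakDeriv ψ).choose
      map_add' := by
        intro ψ φ
        obtain ⟨ψ₁, h⟩ := (exists_second_weakDeriv ψ).choose_spec
        obtain ⟨φ₁, k⟩ := (exists_second_weakDeriv φ).choose_spec
        obtain ⟨χ₁, l⟩ := (exists_second_weakDeriv (ψ + φ)).choose_spec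
        rw [l.unique (φ₁ := ψ₁ + φ₁) ⟨h.1.add k.1, h.2.add k.2⟩, neg_add]
      map_smul' := by
        intro c ψ
        obtain ⟨ψ₁, h⟩ := (exists_second_weakDeriv ψ).choose_spec
        obtain ⟨χ₁, l⟩ := (exists_second_weakDeriv (c • ψ)).choose_spec
        rw [l.unique (φ₁ := c • ψ₁) ⟨h.1.smul c, h.2.smul c⟩, RingHom.id_apply, smul_neg] }

lemma robin_apply {a : ℝ} {cm cp : ℂ} (ψ : (robin a cm cp).domain) {ψ₁ ψ₂ : L2 a}
    (h : HasTwoWeakDerivs a ψ ψ₁ ψ₂) : robin a cm cp ψ = -ψ₂ := by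
  obtain ⟨_, l⟩ := (exists_second_weakDeriv (a := a) (cm := cm) (cp := cp) ψ).choose_spec
  exact congrArg Neg.neg (l.unique h)

section Spectral

variable {E : Type*} [AddCommGroup E] [Module ℂ E]

/-- `x` is an eigenvector of the (unbounded) operator `A` for the eigenvalue `μ`. -/
def IsEigenvector (A : E →ₗ.[ℂ] E) (μ : ℂ) (x : E) : Prop :=
  x ≠ 0 ∧ ∃ y : A.domain, (y : E) = x ∧ A y = μ • x

/-- `μ` is an eigenvalue of the (unbounded) operator `A`. -/
def IsEigenvalue (A : E →ₗ.[ℂ] E) (μ : ℂ) : Prop :=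
  ∃ x : E, IsEigenvector A μ x

/-- `ker (A - μ)^k`, on the natural domain of the power: `x ∈ ker (A - μ)^(k+1)` iff
`x ∈ Dom A` and `(A - μ) x ∈ ker (A - μ)^k`. -/
def kerPow (A : E →ₗ.[ℂ] E) (μ : ℂ) : ℕ → Submodule ℂ E
  | 0 => ⊥
  | k + 1 => ((kerPow A μ k).comap (A.toFun - μ • A.domain.subtype)).map A.domain.subtype

/-- `μ` is a simple eigenvalue of `A`: its algebraic multiplicity, that is the dimension of the
space `⋃ₖ ker (A - μ)^k` of generalized eigenvectors, is one. -/
def IsSimpleEigenvalue (A : E →ₗ.[ℂ] E) (μ : ℂ) : Prop :=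
  Module.finrank ℂ (⨆ k, kerPow A μ k : Submodule ℂ E) = 1

end Spectral

/-- A bounded operator `T` is Hilbert–Schmidt if `∑ ‖T bᵢ‖² < ∞` for every orthonormal basis
`(bᵢ)`. -/
def IsHilbertSchmidt.{u} {E : Type u} [NormedAddCommGroup E] [InnerProductSpace ℂ E]
    (T : E →L[ℂ] E) : Prop :=
  ∀ {ι : Type u} (b : HilbertBasis ι ℂ E), Summable fun i => ‖T (b i)‖ ^ 2

/-- The Neumann eigenfunctions: `1/√(2a)` for `n = 0` and `cos (k_n (x+a)) / √a` with
`k_n = nπ/(2a)` for `n ≥ 1`. -/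
def neumannFun (a : ℝ) (n : ℕ) (x : ℝ) : ℂ :=
  if n = 0 then ((1 / √(2 * a) : ℝ) : ℂ)
  else ((1 / √a * Real.cos (n * Real.pi / (2 * a) * (x + a)) : ℝ) : ℂ)

lemma memLp_neumannFun (a : ℝ) (n : ℕ) :
    MemLp (neumannFun a n) 2 (volume.restrict (Ioo (-a) a)) := by
  have hc : Continuous (neumannFun a n) := by
    unfold neumannFun
    split_ifs <;> fun_prop
  refine MemLp.of_bound hc.aestronglyMeasurable (|1 / √(2 * a)| + |1 / √a|)
    (Eventually.of_forall fun x => ?_)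
  unfold neumannFun
  split_ifs
  · rw [Complex.norm_real, Real.norm_eq_abs]
    linarith [abs_nonneg (1 / √a)]
  · rw [Complex.norm_real, Real.norm_eq_abs, abs_mul]
    have h1 := Real.abs_cos_le_one (n * Real.pi / (2 * a) * (x + a))
    have h2 := abs_nonneg (1 / √a)
    have h3 := abs_nonneg (1 / √(2 * a))
    nlinarith

/-- The Neumann eigenfunction `χ_n^N` as an element of `L²(-a,a)`. -/
def neumannMode (a : ℝ) (n : ℕ) : L2 a := (memLp_neumannFun a n).toLp

end RobinInterval

end

/-! Put d = 2a. In the coordinates of (e_n), Ω − U sends f to (⟨φ_n − χ_n^N, f⟩)_n, and such an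
operator is Hilbert–Schmidt as soon as ∑ ‖φ_n − χ_n^N‖² < ∞ (`exists_hilbertSchmidt_of_summable`).
Everything thus rests on the uniform bound φ_n − χ_n^N = O(1/n), with the two sequences correctly
matched index by index.

The eigenvalues are the zeros of the entire function F = `charFun d cm cp`, with F(l²) = l sin(ld) +
(c₋ − c₊) cos(ld) + c₊c₋ sin(ld)/l. On the circles |l| = (N + 1/2)π/d the first term dominates for
large N, and Rouché's theorem against the Neumann case l sin(ld) gives exactly N + 1 zeros inside
(`ncard_zeros_charFun`). Zeros are counted as points, so they must be simple. For u the solution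
with u = 1 at the left end, Green's identity gives F'(μ) = ∫u² / u(d); if ∫u² = 0, variation of
constants puts u in the range of H − μ, and the resulting Jordan chain contradicts algebraic
simplicity (`integral_sq_ne_zero`).

The count and the ordering of |λ_n| force λ_n into the n-th annulus for large n
(`norm_enumeration_mem`). There F = 0 makes sin(ld) = O(1/|l|) cos(ld), hence l_n d = nπ + O(1/n)
for a suitable root, and the solutions converge to cosines at the rate 1/n (`robinSol_asymptotic`).

The adjoint is never computed. Its eigenvector φ_n is orthogonal to the range of H − λ_n, which
contains the orthogonal complement of conj u; so φ_n is a multiple of conj u, fixed by the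
normalization (`eq_smul_of_isEigenvector_adjoint`). Unitarity of U is the completeness of the
cosines, which follows from Weierstrass approximation in the variable cos (`neumannBasis`). -/

noncomputable section

namespace RobinInterval

/-! ### Solutions of −u'' = μu as entire functions of μ -/

/-- `f ∘ √`, for an even function `f`. -/
def sqrtLift (f : ℂ → ℂ) (z : ℂ) : ℂ := f (z ^ (1 / 2 : ℂ))

lemma cpow_half_sq (z : ℂ) : (z ^ (1 / 2 : ℂ)) ^ 2 = z := by
  simp

lemma sqrtLift_sq {f : ℂ → ℂ} (hf : ∀ z, f (-z) = f z) (w : ℂ) : sqrtLift f (w ^ 2) = f w := by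
  rcases sq_eq_sq_iff_eq_or_eq_neg.mp (cpow_half_sq (w ^ 2)) with h | h
  · rw [sqrtLift, h]
  · rw [sqrtLift, h, hf]

lemma norm_cpow_half (z : ℂ) : ‖z ^ (1 / 2 : ℂ)‖ = √‖z‖ := by
  rw [eq_comm, Real.sqrt_eq_iff_mul_self_eq (norm_nonneg _) (norm_nonneg _), ← norm_mul, ← sq,
    cpow_half_sq]

lemma continuousAt_cpow_half_zero : ContinuousAt (fun z : ℂ => z ^ (1 / 2 : ℂ)) 0 := by
  have h0 : (0 : ℂ) ^ (1 / 2 : ℂ) = 0 := by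
    rw [← norm_eq_zero, norm_cpow_half]; simp
  rw [ContinuousAt, h0, tendsto_zero_iff_norm_tendsto_zero]
  simp only [norm_cpow_half]
  have : Continuous fun z : ℂ => √‖z‖ := by fun_prop
  simpa using this.tendsto 0

/-- Near z ≠ 0 the squaring map has a holomorphic local inverse, and evenness makes f of any square
root the same, so the branch cut of the power is invisible. At 0 the singularity is removable by
continuity. -/
lemma differentiable_sqrtLift {f : ℂ → ℂ} (hd : Differentiable ℂ f) (hf : ∀ z, f (-z) = f z) :
    Differentiable ℂ (sqrtLift f) := by
  have hne : ∀ z : ℂ, z ≠ 0 → DifferentiableAt ℂ (sqrtLift f) z := by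
    intro z hz
    set w := z ^ (1 / 2 : ℂ) with hw
    have hwz : w ^ 2 = z := cpow_half_sq z
    have hw0 : w ≠ 0 := by rintro h; apply hz; rw [← hwz, h]; simp
    have hs : HasStrictDerivAt (fun u : ℂ => u ^ 2) (2 * w) w := by
      simpa using hasStrictDerivAt_pow 2 w
    have hs0 : 2 * w ≠ 0 := mul_ne_zero two_ne_zero hw0
    have h1 := hs.to_localInverse hs0
    have h2 := hs.hasStrictFDerivAt_equiv hs0 |>.eventually_right_inverse
    simp only [hwz] at h1 h2
    have h3 : sqrtLift f =ᶠ[nhds z] fun y => f (hs.localInverse (fun u : ℂ => u ^ 2) _ w hs0 y) := by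
      filter_upwards [h2] with y hy
      rw [← sqrtLift_sq hf (hs.localInverse _ _ w hs0 y)]
      exact congrArg _ hy.symm
    refine DifferentiableAt.congr_of_eventuallyEq ?_ h3
    exact (hd _).comp z h1.hasDerivAt.differentiableAt
  intro z
  by_cases hz : z = 0
  · subst hz
    refine (Complex.analyticAt_of_differentiable_on_punctured_nhds_of_continuousAt
      ?_ ?_).differentiableAt
    · filter_upwards [self_mem_nhdsWithin] with z hz using hne z hz
    · exact hd.continuous.continuousAt.comp continuousAt_cpow_half_zero
  · exact hne z hz

/-- `sin z / z`, entire. -/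
def csinc : ℂ → ℂ := dslope Complex.sin 0

lemma differentiable_csinc : Differentiable ℂ csinc := by
  have := (Complex.differentiableOn_dslope (s := univ) (c := (0 : ℂ)) univ_mem).mpr
    Complex.differentiable_sin.differentiableOn
  exact differentiableOn_univ.mp this

lemma mul_csinc (z : ℂ) : z * csinc z = Complex.sin z := by
  have := sub_smul_dslope Complex.sin 0 z
  simpa [csinc] using this

@[simp] lemma csinc_zero : csinc 0 = 1 := by
  simp [csinc, dslope_same]

lemma csinc_neg (z : ℂ) : csinc (-z) = csinc z := by
  by_cases hz : z = 0
  · simp [hz]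
  · apply mul_left_cancel₀ hz
    rw [mul_csinc]
    have := mul_csinc (-z)
    rw [Complex.sin_neg] at this
    linear_combination -this

/-- `cos (√μ y)`, as a function of `μ` and `y`: the solution of `u'' = -μ u` with `u(0) = 1`,
`u'(0) = 0`. -/
def cosSol (μ : ℂ) (y : ℝ) : ℂ := sqrtLift Complex.cos (μ * y ^ 2)

/-- `sin (√μ y) / √μ`, as a function of `μ` and `y`: the solution of `u'' = -μ u` with `u(0) = 0`,
`u'(0) = 1`. -/
def sinSol (μ : ℂ) (y : ℝ) : ℂ := y * sqrtLift csinc (μ * y ^ 2)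

lemma cosSol_sq (l : ℂ) (y : ℝ) : cosSol (l ^ 2) y = Complex.cos (l * y) := by
  rw [cosSol, ← mul_pow, sqrtLift_sq Complex.cos_neg]

lemma sinSol_sq (l : ℂ) (y : ℝ) : l * sinSol (l ^ 2) y = Complex.sin (l * y) := by
  rw [sinSol, ← mul_pow, sqrtLift_sq csinc_neg, ← mul_assoc, mul_csinc]

lemma sinSol_sq_of_ne {l : ℂ} (hl : l ≠ 0) (y : ℝ) :
    sinSol (l ^ 2) y = Complex.sin (l * y) / l := by
  rw [← sinSol_sq, mul_div_cancel_left₀ _ hl]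

lemma sinSol_zero_left (y : ℝ) : sinSol 0 y = y := by
  have := sqrtLift_sq csinc_neg 0
  rw [zero_pow two_ne_zero, csinc_zero] at this
  rw [sinSol, zero_mul, this, mul_one]

lemma cosSol_zero_left (y : ℝ) : cosSol 0 y = 1 := by
  have := cosSol_sq 0 y
  simpa using this

@[simp] lemma cosSol_zero (μ : ℂ) : cosSol μ 0 = 1 := by
  rw [← cpow_half_sq μ, cosSol_sq]; simp

@[simp] lemma sinSol_zero (μ : ℂ) : sinSol μ 0 = 0 := by
  simp [sinSol]

lemma hasDerivAt_cosSol (μ : ℂ) (y : ℝ) : HasDerivAt (cosSol μ) (-μ * sinSol μ y) y := by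
  obtain ⟨l, rfl⟩ : ∃ l, l ^ 2 = μ := ⟨_, cpow_half_sq μ⟩
  have h : HasDerivAt (fun y : ℝ => Complex.cos (l * y)) (-Complex.sin (l * y) * (l * 1)) y :=
    (((hasDerivAt_id (y : ℂ)).const_mul l).ccos).comp_ofReal
  have e : cosSol (l ^ 2) = fun y : ℝ => Complex.cos (l * y) := funext (cosSol_sq l)
  rw [e]
  convert h using 1
  rw [← sinSol_sq]; ring

lemma hasDerivAt_sinSol (μ : ℂ) (y : ℝ) : HasDerivAt (sinSol μ) (cosSol μ y) y := by
  by_cases hμ : μ = 0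
  · subst hμ
    rw [cosSol_zero_left, show sinSol 0 = fun y : ℝ => (y : ℂ) from funext sinSol_zero_left]
    exact (hasDerivAt_id (y : ℂ)).comp_ofReal
  obtain ⟨l, rfl⟩ : ∃ l, l ^ 2 = μ := ⟨_, cpow_half_sq μ⟩
  have hl : l ≠ 0 := by rintro rfl; simp at hμ
  have h : HasDerivAt (fun y : ℝ => Complex.sin (l * y) / l) (Complex.cos (l * y) * (l * 1) / l) y :=
    ((((hasDerivAt_id (y : ℂ)).const_mul l).csin).comp_ofReal).div_const l
  have e : sinSol (l ^ 2) = fun y : ℝ => Complex.sin (l * y) / l := funext (sinSol_sq_of_ne hl)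
  rw [e, cosSol_sq]
  convert h using 1
  field_simp

/-- This is the constant Wronskian of the fundamental pair; it is what recovers a solution from its
Cauchy data. -/
lemma cosSol_sq_add (μ : ℂ) (y : ℝ) : cosSol μ y ^ 2 + μ * sinSol μ y ^ 2 = 1 := by
  obtain ⟨l, rfl⟩ : ∃ l, l ^ 2 = μ := ⟨_, cpow_half_sq μ⟩
  rw [← mul_pow, sinSol_sq, cosSol_sq]
  exact Complex.cos_sq_add_sin_sq _

lemma continuous_uncurry_cosSol : Continuous fun p : ℂ × ℝ => cosSol p.1 p.2 := by
  have := (differentiable_sqrtLift Complex.differentiable_cos Complex.cos_neg).continuous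
  unfold cosSol
  fun_prop

lemma continuous_uncurry_sinSol : Continuous fun p : ℂ × ℝ => sinSol p.1 p.2 := by
  have := (differentiable_sqrtLift differentiable_csinc csinc_neg).continuous
  unfold sinSol
  fun_prop

@[fun_prop] lemma continuous_cosSol (μ : ℂ) : Continuous (cosSol μ) :=
  continuous_iff_continuousAt.mpr fun y => (hasDerivAt_cosSol μ y).continuousAt

@[fun_prop] lemma continuous_sinSol (μ : ℂ) : Continuous (sinSol μ) :=
  continuous_iff_continuousAt.mpr fun y => (hasDerivAt_sinSol μ y).continuousAt

lemma differentiable_cosSol (y : ℝ) : Differentiable ℂ fun μ => cosSol μ y := by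
  have := differentiable_sqrtLift Complex.differentiable_cos Complex.cos_neg
  unfold cosSol
  fun_prop

lemma differentiable_sinSol (y : ℝ) : Differentiable ℂ fun μ => sinSol μ y := by
  have := differentiable_sqrtLift differentiable_csinc csinc_neg
  unfold sinSol
  fun_prop

/-! ### The characteristic function and the simplicity of its zeros -/

/-- The solution of `-u'' = μ u` with `u(0) = 1` and `u'(0) = -c`. -/
def robinSol (c μ : ℂ) (y : ℝ) : ℂ := cosSol μ y - c * sinSol μ y

/-- The derivative of `robinSol`. -/
def robinSol' (c μ : ℂ) (y : ℝ) : ℂ := -μ * sinSol μ y - c * cosSol μ y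

lemma hasDerivAt_robinSol (c μ : ℂ) (y : ℝ) :
    HasDerivAt (robinSol c μ) (robinSol' c μ y) y :=
  (hasDerivAt_cosSol μ y).sub ((hasDerivAt_sinSol μ y).const_mul c)

lemma hasDerivAt_robinSol' (c μ : ℂ) (y : ℝ) :
    HasDerivAt (robinSol' c μ) (-μ * robinSol c μ y) y := by
  have := ((hasDerivAt_sinSol μ y).const_mul (-μ)).sub ((hasDerivAt_cosSol μ y).const_mul c)
  refine this.congr_deriv ?_
  rw [robinSol]; ring

@[fun_prop] lemma continuous_robinSol (c μ : ℂ) : Continuous (robinSol c μ) := by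
  unfold robinSol; fun_prop

@[fun_prop] lemma continuous_robinSol' (c μ : ℂ) : Continuous (robinSol' c μ) := by
  unfold robinSol'; fun_prop

@[simp] lemma robinSol_zero (c μ : ℂ) : robinSol c μ 0 = 1 := by simp [robinSol]

@[simp] lemma robinSol'_zero (c μ : ℂ) : robinSol' c μ 0 = -c := by simp [robinSol']

/-- The characteristic function `-(u'(d) + c₊ u(d))` of the Robin problem on an interval of length
`d`, where `u = robinSol c₋ μ`. -/
def charFun (d : ℝ) (cm cp μ : ℂ) : ℂ :=
  μ * sinSol μ d + (cm - cp) * cosSol μ d + cp * cm * sinSol μ d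

lemma charFun_eq (d : ℝ) (cm cp μ : ℂ) :
    charFun d cm cp μ = -(robinSol' cm μ d + cp * robinSol cm μ d) := by
  rw [charFun, robinSol, robinSol']; ring

lemma differentiable_charFun (d : ℝ) (cm cp : ℂ) : Differentiable ℂ (charFun d cm cp) := by
  have := differentiable_cosSol d
  have := differentiable_sinSol d
  unfold charFun
  fun_prop

/-- At an eigenvalue, the solution normalized at the left end does not vanish at the right end. -/
lemma robinSol_ne_zero {d : ℝ} {cm cp μ : ℂ} (h : charFun d cm cp μ = 0) : robinSol cm μ d ≠ 0 := by
  intro h0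
  have h1 : robinSol' cm μ d = 0 := by
    rw [charFun_eq, h0] at h; simpa using h
  have h2 := cosSol_sq_add μ d
  -- Vanishing Cauchy data at d would contradict the Wronskian identity.
  rw [robinSol] at h0
  rw [robinSol'] at h1
  apply one_ne_zero (α := ℂ)
  linear_combination cosSol μ d * h0 - sinSol μ d * h1 - h2

/-- Green's identity between `robinSol c μ` and `robinSol c ν`. -/
lemma integral_robinSol_mul (d : ℝ) {cm cp μ : ℂ} (ν : ℂ) (h : charFun d cm cp μ = 0) :
    robinSol cm μ d * charFun d cm cp ν
      = (ν - μ) * ∫ y in (0 : ℝ)..d, robinSol cm μ y * robinSol cm ν y := by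
  -- The Wronskian of the two solutions vanishes at 0, where both have Cauchy data (1, −c₋). At d
  -- the condition u'(d) = −c₊u(d) for μ turns it into the left-hand side.
  have hd : ∀ y : ℝ, HasDerivAt
      (fun y => robinSol' cm μ y * robinSol cm ν y - robinSol cm μ y * robinSol' cm ν y)
      ((ν - μ) * (robinSol cm μ y * robinSol cm ν y)) y := by
    intro y
    have := ((hasDerivAt_robinSol' cm μ y).mul (hasDerivAt_robinSol cm ν y)).sub
      ((hasDerivAt_robinSol cm μ y).mul (hasDerivAt_robinSol' cm ν y))
    refine this.congr_deriv ?_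
    ring
  have hi := intervalIntegral.integral_eq_sub_of_hasDerivAt (a := 0) (b := d) (fun y _ => hd y)
    ((by fun_prop : Continuous fun y => (ν - μ) * (robinSol cm μ y * robinSol cm ν y)
      ).intervalIntegrable _ _)
  rw [intervalIntegral.integral_const_mul] at hi
  rw [hi, charFun_eq]
  rw [charFun_eq] at h
  simp only [robinSol_zero, robinSol'_zero]
  linear_combination robinSol cm ν d * h

/-- A zero of the characteristic function at which `∫ u² ≠ 0` is simple. -/
lemma deriv_charFun_ne_zero {d : ℝ} {cm cp μ : ℂ} (h : charFun d cm cp μ = 0)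
    (hi : ∫ y in (0 : ℝ)..d, robinSol cm μ y ^ 2 ≠ 0) : deriv (charFun d cm cp) μ ≠ 0 := by
  set K : ℂ → ℂ := fun ν => ∫ y in (0 : ℝ)..d, robinSol cm μ y * robinSol cm ν y with hK
  have hKc : Continuous K := by
    apply intervalIntegral.continuous_parametric_intervalIntegral_of_continuous'
    have h1 := continuous_uncurry_cosSol
    have h2 := continuous_uncurry_sinSol
    have h3 : Continuous fun p : ℂ × ℝ => robinSol cm p.1 p.2 := by
      unfold robinSol; fun_prop
    exact ((continuous_robinSol cm μ).comp continuous_snd).mul h3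
  have h0 := robinSol_ne_zero h
  -- F is (ν − μ) times a function of ν that is continuous at μ, so F'(μ) is the value of that
  -- function there; no differentiation under the integral is needed.
  have hF : charFun d cm cp = fun ν => (ν - μ) * (K ν / robinSol cm μ d) := by
    funext ν
    have := integral_robinSol_mul d ν h
    rw [mul_div_assoc', ← this, mul_div_cancel_left₀ _ h0]
  have hder : HasDerivAt (charFun d cm cp) (K μ / robinSol cm μ d) μ := by
    rw [hasDerivAt_iff_tendsto_slope]
    have ht : Tendsto (fun ν => K ν / robinSol cm μ d) (nhdsWithin μ {μ}ᶜ)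
        (nhds (K μ / robinSol cm μ d)) :=
      ((hKc.div_const _).tendsto μ).mono_left nhdsWithin_le_nhds
    refine ht.congr' ?_
    filter_upwards [self_mem_nhdsWithin] with ν hν
    have hν' : ν - μ ≠ 0 := sub_ne_zero.mpr hν
    rw [slope_def_field, h, hF]
    field_simp
    simp
  rw [hder.deriv]
  refine div_ne_zero ?_ h0
  simpa [hK, ← sq] using hi

/-! ### Argument principle and Rouché's theorem for simple zeros -/

section Rouche

open Metric

/-- An entire function vanishing at the points of a finite set is divisible by the corresponding
monic polynomial. -/
lemma exists_eq_prod_mul {f : ℂ → ℂ} (hf : Differentiable ℂ f) (Z : Finset ℂ)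
    (hZ : ∀ u ∈ Z, f u = 0) :
    ∃ g : ℂ → ℂ, Differentiable ℂ g ∧ ∀ z, f z = (∏ u ∈ Z, (z - u)) * g z := by
  induction Z using Finset.induction_on with
  | empty => exact ⟨f, hf, by simp⟩
  | insert u Z hu ih =>
    obtain ⟨g, hg, hfg⟩ := ih fun v hv => hZ v (Finset.mem_insert_of_mem hv)
    have hgu : g u = 0 := by
      have := hZ u (Finset.mem_insert_self u Z)
      rw [hfg, mul_eq_zero, Finset.prod_eq_zero_iff] at this
      rcases this with ⟨v, hv, hv'⟩ | h
      · rw [sub_eq_zero.mp hv'] at hu; exact absurd hv hu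
      · exact h
    refine ⟨dslope g u, ?_, fun z => ?_⟩
    · exact differentiableOn_univ.mp ((Complex.differentiableOn_dslope univ_mem).mpr hg.differentiableOn)
    · have := sub_smul_dslope g u z
      rw [hgu, sub_zero, smul_eq_mul] at this
      rw [hfg, ← this, Finset.prod_insert hu]
      ring

/-- The argument principle for an entire function with simple zeros. -/
lemma circleIntegral_logDeriv_eq_card {f : ℂ → ℂ} (hf : Differentiable ℂ f) {R : ℝ} (hR : 0 < R)
    (Z : Finset ℂ) (hZ : ∀ z ∈ closedBall (0 : ℂ) R, f z = 0 ↔ z ∈ Z)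
    (hZR : ∀ u ∈ Z, ‖u‖ < R)
    (hs : ∀ u ∈ Z, deriv f u ≠ 0) :
    ∮ z in C(0, R), logDeriv f z = 2 * Real.pi * Complex.I * Z.card := by
  have hZ0 : ∀ u ∈ Z, f u = 0 := fun u hu =>
    (hZ u (by simpa using (hZR u hu).le)).mpr hu
  obtain ⟨g, hg, hfg⟩ := exists_eq_prod_mul hf Z hZ0
  -- A zero of `g` in the disc would be a point of `Z` where both factors of f vanish, so f' would
  -- vanish there too.
  have hg0 : ∀ z ∈ closedBall (0 : ℂ) R, g z ≠ 0 := by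
    intro z hz h
    have hzZ : z ∈ Z := (hZ z hz).mp (by rw [hfg, h, mul_zero])
    apply hs z hzZ
    have hp : DifferentiableAt ℂ (fun z => ∏ u ∈ Z, (z - u)) z := by fun_prop
    have : HasDerivAt f _ z := (hp.hasDerivAt.mul (hg z).hasDerivAt).congr_of_eventuallyEq
      (Eventually.of_forall hfg)
    rw [this.deriv, h, Finset.prod_eq_zero hzZ (sub_self z)]
    ring
  have hsub : ∀ z ∈ sphere (0 : ℂ) R, ∀ u ∈ Z, z - u ≠ 0 := by
    intro z hz u hu h
    have := hZR u hu
    rw [← sub_eq_zero.mp h, mem_sphere_zero_iff_norm.mp hz] at this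
    exact lt_irrefl _ this
  have hlog : EqOn (logDeriv f) (fun z => ∑ u ∈ Z, (z - u)⁻¹ + logDeriv g z) (sphere 0 R) := by
    intro z hz
    have e : f = fun z => (∏ u ∈ Z, (z - u)) * g z := funext hfg
    rw [e]
    rw [logDeriv_mul z (Finset.prod_ne_zero_iff.mpr (hsub z hz)) (hg0 z (sphere_subset_closedBall hz))
      (by fun_prop) (hg z)]
    congr 1
    rw [logDeriv_prod (hf := hsub z hz) (hd := by intros; fun_prop)]
    refine Finset.sum_congr rfl fun u _ => ?_
    rw [logDeriv_apply, deriv_sub_const, deriv_id'', one_div]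
  have hc1 : ∀ u ∈ Z, CircleIntegrable (fun z => (z - u)⁻¹) 0 R := by
    intro u hu
    refine ContinuousOn.circleIntegrable hR.le fun z hz => ?_
    have : ContinuousAt (fun z : ℂ => z - u) z := by fun_prop
    exact (this.inv₀ (hsub z hz u hu)).continuousWithinAt
  have hgl : DifferentiableOn ℂ (logDeriv g) (closedBall 0 R) := by
    intro z hz
    refine DifferentiableAt.differentiableWithinAt ?_
    exact (hg.deriv z).div (hg z) (hg0 z hz)
  have hc2 : CircleIntegrable (logDeriv g) 0 R :=
    (hgl.continuousOn.mono sphere_subset_closedBall).circleIntegrable hR.le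
  rw [circleIntegral.integral_congr hR.le hlog,
    circleIntegral.integral_add (CircleIntegrable.fun_sum _ hc1) hc2,
    circleIntegral.integral_fun_sum hc1]
  have h2 : ∮ z in C(0, R), logDeriv g z = 0 := by
    apply Complex.circleIntegral_eq_zero_of_differentiable_on_off_countable hR.le countable_empty
      hgl.continuousOn
    intro z hz
    exact (hg.deriv z).div (hg z) (hg0 z (ball_subset_closedBall hz.1))
  rw [h2, add_zero, Finset.sum_congr rfl fun u hu =>
    circleIntegral.integral_sub_inv_of_mem_ball (by simpa using hZR u hu)]
  rw [Finset.sum_const, nsmul_eq_mul, mul_comm]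

/-- An entire function all of whose zeros are simple has finitely many of them in each disc. -/
lemma finite_zeros_of_deriv_ne_zero {f : ℂ → ℂ} (hf : Differentiable ℂ f) (R : ℝ)
    (hs : ∀ z, f z = 0 → deriv f z ≠ 0) : {z | f z = 0 ∧ ‖z‖ ≤ R}.Finite := by
  by_contra hinf
  obtain ⟨z, -, hz⟩ := Set.Infinite.exists_accPt_of_subset_isCompact
    (K := closedBall (0 : ℂ) R) hinf (isCompact_closedBall 0 R) (fun z hz => by simpa using hz.2)
  rw [accPt_iff_frequently] at hz
  have hfz : f z = 0 := by
    have hcl : IsClosed {z | f z = 0} := isClosed_eq hf.continuous continuous_const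
    by_contra h
    have : ∀ᶠ w in nhds z, f w ≠ 0 := hcl.isOpen_compl.mem_nhds h
    obtain ⟨w, hw, hw'⟩ := (hz.and_eventually this).exists
    exact hw' hw.2.1
  -- A zero with nonzero derivative is isolated, so it cannot be an accumulation point of zeros.
  have := (hf z).hasDerivAt.eventually_ne (c := (0 : ℂ)) (hs z hfz)
  rw [eventually_nhdsWithin_iff] at this
  obtain ⟨w, hw, hw'⟩ := (hz.and_eventually this).exists
  exact hw' hw.1 hw.2.1

/-- Rouché's theorem for entire functions with simple zeros. -/
lemma ncard_zeros_eq_of_norm_sub_lt {f g : ℂ → ℂ} (hf : Differentiable ℂ f)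
    (hg : Differentiable ℂ g) (hfs : ∀ z, f z = 0 → deriv f z ≠ 0)
    (hgs : ∀ z, g z = 0 → deriv g z ≠ 0) {R : ℝ} (hR : 0 < R)
    (h : ∀ z, ‖z‖ = R → ‖f z - g z‖ < ‖g z‖) :
    {z | f z = 0 ∧ ‖z‖ < R}.ncard = {z | g z = 0 ∧ ‖z‖ < R}.ncard := by
  have hg0 : ∀ z, ‖z‖ = R → g z ≠ 0 := fun z hz h0 => by
    have := h z hz
    rw [h0, norm_zero] at this
    exact absurd (norm_nonneg _) (not_le.mpr this)
  have hf0 : ∀ z, ‖z‖ = R → f z ≠ 0 := fun z hz h0 => by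
    have := h z hz
    rw [h0, zero_sub, norm_neg] at this
    exact lt_irrefl _ this
  have key : ∀ k : ℂ → ℂ, Differentiable ℂ k → (∀ z, k z = 0 → deriv k z ≠ 0) →
      (∀ z, ‖z‖ = R → k z ≠ 0) →
      ∮ z in C(0, R), logDeriv k z
        = 2 * Real.pi * Complex.I * ({z | k z = 0 ∧ ‖z‖ < R}.ncard : ℂ) := by
    intro k hk hks hk0
    have hfin : {z | k z = 0 ∧ ‖z‖ < R}.Finite :=
      (finite_zeros_of_deriv_ne_zero hk R hks).subset fun z hz => ⟨hz.1, hz.2.le⟩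
    rw [circleIntegral_logDeriv_eq_card hk hR hfin.toFinset,
      Set.ncard_eq_toFinset_card _ hfin]
    · intro z hz
      rw [hfin.mem_toFinset]
      refine ⟨fun h => ⟨h, ?_⟩, fun h => h.1⟩
      have hz' : ‖z‖ ≤ R := by simpa using hz
      exact lt_of_le_of_ne hz' fun h' => hk0 z h' h
    · intro u hu
      exact (hfin.mem_toFinset.mp hu).2
    · intro u hu
      exact hks u (hfin.mem_toFinset.mp hu).1
  -- On the circle f/g stays within distance 1 of 1, hence in the slit plane; log(f/g) is then a
  -- single-valued primitive of the difference of the logarithmic derivatives.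
  have hz : ∮ z in C(0, R), (logDeriv f z - logDeriv g z) = 0 := by
    refine circleIntegral.integral_eq_zero_of_hasDerivWithinAt hR.le
      (f := fun z => Complex.log (f z / g z)) fun z hz => HasDerivAt.hasDerivWithinAt ?_
    have hz' : ‖z‖ = R := mem_sphere_zero_iff_norm.mp hz
    have hmem : f z / g z ∈ Complex.slitPlane := by
      apply Complex.ball_one_subset_slitPlane
      rw [mem_ball, dist_eq_norm, div_sub_one (hg0 z hz'), norm_div,
        div_lt_one (norm_pos_iff.mpr (hg0 z hz'))]
      exact h z hz'
    have := ((hf z).hasDerivAt.div (hg z).hasDerivAt (hg0 z hz')).clog hmem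
    refine this.congr_deriv ?_
    have := hf0 z hz'
    have := hg0 z hz'
    simp only [logDeriv_apply, Pi.div_apply]
    field_simp
  have hci : ∀ k : ℂ → ℂ, Differentiable ℂ k → (∀ z, ‖z‖ = R → k z ≠ 0) →
      CircleIntegrable (logDeriv k) 0 R := by
    intro k hk hk0
    refine ContinuousOn.circleIntegrable hR.le fun z hz => ContinuousAt.continuousWithinAt ?_
    exact hk.deriv.continuous.continuousAt.div hk.continuous.continuousAt
      (hk0 z (mem_sphere_zero_iff_norm.mp hz))
  rw [circleIntegral.integral_sub (hci f hf hf0) (hci g hg hg0), key f hf hfs hf0,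
    key g hg hgs hg0, ← mul_sub, mul_eq_zero, sub_eq_zero] at hz
  rcases hz with hz | hz
  · exact absurd hz Complex.two_pi_I_ne_zero
  · exact_mod_cast hz

end Rouche

/-! ### Counting the zeros in large discs -/

lemma norm_sin_sq (z : ℂ) : ‖Complex.sin z‖ ^ 2 = Real.sin z.re ^ 2 + Real.sinh z.im ^ 2 := by
  rw [Complex.sq_norm, Complex.sin_eq, ← Complex.ofReal_sin, ← Complex.ofReal_cos,
    ← Complex.ofReal_sinh, ← Complex.ofReal_cosh, ← Complex.ofReal_mul, ← Complex.ofReal_mul,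
    Complex.normSq_add_mul_I]
  have h1 := Real.sin_sq_add_cos_sq z.re
  have h2 := Real.cosh_sq z.im
  linear_combination Real.sin z.re ^ 2 * h2 + Real.sinh z.im ^ 2 * h1

lemma norm_cos_sq (z : ℂ) : ‖Complex.cos z‖ ^ 2 = Real.cos z.re ^ 2 + Real.sinh z.im ^ 2 := by
  rw [Complex.sq_norm, Complex.cos_eq, ← Complex.ofReal_sin, ← Complex.ofReal_cos,
    ← Complex.ofReal_sinh, ← Complex.ofReal_cosh, ← Complex.ofReal_mul, ← Complex.ofReal_mul,
    sub_eq_add_neg, ← neg_mul, ← Complex.ofReal_neg, Complex.normSq_add_mul_I]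
  have h1 := Real.sin_sq_add_cos_sq z.re
  have h2 := Real.cosh_sq z.im
  linear_combination Real.cos z.re ^ 2 * h2 + Real.sinh z.im ^ 2 * h1

lemma sq_le_sinh_sq (y : ℝ) : y ^ 2 ≤ Real.sinh y ^ 2 := by
  rw [← sq_abs y, ← sq_abs (Real.sinh y), Real.abs_sinh]
  exact pow_le_pow_left₀ (abs_nonneg _) (Real.self_le_sinh_iff.mpr (abs_nonneg y)) 2

/-- On the circles of radius `(N + 1/2)π`, the cosine is controlled by the sine. -/
lemma norm_cos_le_two_mul_norm_sin {z : ℂ} {N : ℕ} (hN : 1 ≤ N)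
    (hz : ‖z‖ = (N + 1 / 2) * Real.pi) : ‖Complex.cos z‖ ≤ 2 * ‖Complex.sin z‖ := by
  have hsq : ‖Complex.cos z‖ ^ 2 ≤ 2 * ‖Complex.sin z‖ ^ 2 := by
    rw [norm_sin_sq, norm_cos_sq]
    have h1 := Real.sin_sq_add_cos_sq z.re
    have hsh := sq_le_sinh_sq z.im
    -- If |Im z| ≥ 1, then sinh² Im z ≥ 1 dominates cos² Re z. Otherwise z is so close to the real
    -- axis that |Re z| is within 1/4 of (N + 1/2)π, where sin² ≥ 1/2; N ≥ 1 ensures ‖z‖ ≥ 4, which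
    -- gives the 1/4.
    by_cases hy : 1 ≤ z.im ^ 2
    · nlinarith [sq_nonneg (Real.sin z.re)]
    · push Not at hy
      have hr : 4 ≤ ‖z‖ := by
        have : (1 : ℝ) ≤ N := by exact_mod_cast hN
        have := Real.pi_gt_three
        rw [hz]; nlinarith
      have hn : ‖z‖ ^ 2 = z.re ^ 2 + z.im ^ 2 := by
        rw [Complex.sq_norm, Complex.normSq_apply]; ring
      set t := ‖z‖ - |z.re| with ht
      have ht0 : 0 ≤ t := sub_nonneg.mpr (Complex.abs_re_le_norm z)
      have hcos : 1 - t ^ 2 / 2 ≤ Real.cos t := Real.one_sub_sq_div_two_le_cos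
      have hsin : Real.sin z.re ^ 2 = Real.cos t ^ 2 := by
        have e1 : Real.sin z.re ^ 2 = Real.sin |z.re| ^ 2 := by
          rcases abs_choice z.re with h | h <;> rw [h]
          rw [Real.sin_neg]; ring
        have e2 : |z.re| = N * Real.pi - (t - Real.pi / 2) := by
          rw [ht, hz]; ring
        rw [e1, e2, Real.sin_nat_mul_pi_sub, Real.sin_sub_pi_div_two, neg_sq, mul_pow,
          ← pow_mul, mul_comm N 2, pow_mul]
        simp
      have ht4 : t ≤ 1 / 4 := by
        have : t * (‖z‖ + |z.re|) = z.im ^ 2 := by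
          have := sq_abs z.re
          rw [ht]; linear_combination hn - this
        nlinarith [abs_nonneg z.re]
      have hs3 : 1 / 2 ≤ Real.sin z.re ^ 2 := by
        rw [hsin]
        have : 3 / 4 ≤ Real.cos t := by nlinarith
        nlinarith
      nlinarith [sq_nonneg (Real.sinh z.im)]
  refine le_of_sq_le_sq ?_ (by positivity)
  nlinarith [sq_nonneg ‖Complex.sin z‖]

/-- Radii separating the Neumann eigenvalues `(nπ/d)²`. -/
def sepRadius (d : ℝ) (N : ℕ) : ℝ := (N + 1 / 2) * Real.pi / d

lemma sepRadius_pos {d : ℝ} (hd : 0 < d) (N : ℕ) : 0 < sepRadius d N := by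
  have := Real.pi_pos
  unfold sepRadius; positivity

lemma charFun_sq (d : ℝ) (cm cp l : ℂ) :
    charFun d cm cp (l ^ 2) = l * Complex.sin (l * d) + (cm - cp) * Complex.cos (l * d)
      + cp * cm * sinSol (l ^ 2) d := by
  rw [charFun, ← sinSol_sq, cosSol_sq]; ring

lemma tendsto_sepRadius {d : ℝ} (hd : 0 < d) : Tendsto (sepRadius d) atTop atTop := by
  unfold sepRadius
  refine Tendsto.atTop_div_const hd (Tendsto.atTop_mul_const Real.pi_pos ?_)
  exact tendsto_atTop_add_const_right _ _ tendsto_natCast_atTop_atTop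

lemma charFun_zero_zero_eq_zero_iff {d : ℝ} (hd : 0 < d) (μ : ℂ) :
    charFun d 0 0 μ = 0 ↔ ∃ n : ℕ, μ = (((n * Real.pi / d) ^ 2 : ℝ) : ℂ) := by
  have hdc : (d : ℂ) ≠ 0 := by exact_mod_cast hd.ne'
  constructor
  · intro h
    obtain ⟨l, rfl⟩ : ∃ l, l ^ 2 = μ := ⟨_, cpow_half_sq μ⟩
    rw [charFun_sq] at h
    simp only [sub_self, zero_mul, add_zero, mul_eq_zero] at h
    rcases h with h | h
    · exact ⟨0, by simp [h]⟩
    · obtain ⟨k, hk⟩ := Complex.sin_eq_zero_iff.mp h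
      refine ⟨k.natAbs, ?_⟩
      have hl : l = k * Real.pi / d := by rw [← hk]; field_simp
      have hkk : ((k.natAbs : ℝ)) ^ 2 = (k : ℝ) ^ 2 := by
        rw [Nat.cast_natAbs, Int.cast_abs, sq_abs]
      rw [hl, div_pow, mul_pow, div_pow, mul_pow, hkk]
      push_cast
      ring
  · rintro ⟨n, rfl⟩
    rw [Complex.ofReal_pow, charFun_sq]
    simp only [sub_self, zero_mul, add_zero, mul_eq_zero]
    right
    rw [Complex.sin_eq_zero_iff]
    refine ⟨n, ?_⟩
    push_cast
    field_simp

/-- The Neumann eigenfunctions are real, so the integrand is nonnegative and equals 1 at 0. This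
makes the zeros of the comparison function simple. -/
lemma integral_robinSol_neumann_ne_zero {d : ℝ} (hd : 0 < d) {μ : ℂ} (h : charFun d 0 0 μ = 0) :
    ∫ y in (0 : ℝ)..d, robinSol 0 μ y ^ 2 ≠ 0 := by
  obtain ⟨n, rfl⟩ := (charFun_zero_zero_eq_zero_iff hd μ).mp h
  have e : ∀ y : ℝ, robinSol 0 (((n * Real.pi / d) ^ 2 : ℝ) : ℂ) y ^ 2
      = ((Real.cos (n * Real.pi / d * y) ^ 2 : ℝ) : ℂ) := by
    intro y
    rw [robinSol, zero_mul, sub_zero, Complex.ofReal_pow, cosSol_sq]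
    push_cast
    rfl
  simp only [e]
  rw [intervalIntegral.integral_ofReal, Complex.ofReal_ne_zero]
  refine (intervalIntegral.integral_pos hd (by fun_prop) (fun _ _ => sq_nonneg _)
    ⟨0, left_mem_Icc.mpr hd.le, by simp⟩).ne'

/-- The half-integer in `sepRadius` separates the zeros (nπ/d)² with n ≤ N from the rest. -/
lemma ncard_zeros_neumann {d : ℝ} (hd : 0 < d) (N : ℕ) :
    {μ | charFun d 0 0 μ = 0 ∧ ‖μ‖ < sepRadius d N ^ 2}.ncard = N + 1 := by
  have hpi := Real.pi_pos
  have e : {μ | charFun d 0 0 μ = 0 ∧ ‖μ‖ < sepRadius d N ^ 2}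
      = (fun n : ℕ => (((n * Real.pi / d) ^ 2 : ℝ) : ℂ)) '' (Finset.range (N + 1) : Set ℕ) := by
    ext μ
    simp only [mem_ofPred_eq, charFun_zero_zero_eq_zero_iff hd, mem_image, Finset.coe_range,
      mem_Iio]
    have hiff : ∀ n : ℕ, ‖(((n * Real.pi / d) ^ 2 : ℝ) : ℂ)‖ < sepRadius d N ^ 2 ↔ n < N + 1 := by
      intro n
      rw [Complex.norm_real, Real.norm_of_nonneg (sq_nonneg _),
        sq_lt_sq₀ (by positivity) (sepRadius_pos hd N).le, sepRadius,
        div_lt_div_iff_of_pos_right hd, mul_lt_mul_iff_left₀ hpi]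
      constructor
      · intro h
        by_contra! h'
        have : ((N + 1 : ℕ) : ℝ) ≤ n := by exact_mod_cast h'
        push_cast at this
        linarith
      · intro h
        have : (n : ℝ) ≤ N := by exact_mod_cast Nat.lt_succ_iff.mp h
        linarith
    constructor
    · rintro ⟨⟨n, rfl⟩, h⟩
      exact ⟨n, (hiff n).mp h, rfl⟩
    · rintro ⟨n, hn, rfl⟩
      exact ⟨⟨n, rfl⟩, (hiff n).mpr hn⟩
  rw [e, Set.ncard_image_of_injective, Set.ncard_coe_finset, Finset.card_range]
  intro m n hmn
  have h1 := Complex.ofReal_injective hmn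
  have h2 := (pow_left_inj₀ (by positivity) (by positivity) two_ne_zero).mp h1
  field_simp at h2
  exact_mod_cast h2

/-- The number of zeros of the characteristic function in large discs, if all are simple. -/
lemma ncard_zeros_charFun {d : ℝ} (hd : 0 < d) (cm cp : ℂ)
    (hs : ∀ μ, charFun d cm cp μ = 0 → deriv (charFun d cm cp) μ ≠ 0) :
    ∃ N₀ : ℕ, ∀ N ≥ N₀, {μ | charFun d cm cp μ = 0 ∧ ‖μ‖ < sepRadius d N ^ 2}.ncard = N + 1 := by
  -- The 2 comes from |cos| ≤ 2|sin| on these circles, and the 1 makes |l| ≥ 1, so that |sin(ld)/l|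
  -- ≤ |sin(ld)|. The later `max N₀ 1` supplies the N ≥ 1 required by the cosine bound.
  obtain ⟨N₀, hN₀⟩ := eventually_atTop.mp
    ((tendsto_sepRadius hd).eventually_gt_atTop (2 * ‖cm - cp‖ + ‖cp * cm‖ + 1))
  refine ⟨max N₀ 1, fun N hN => ?_⟩
  rw [← ncard_zeros_neumann hd N]
  have hRpos := sepRadius_pos hd N
  refine ncard_zeros_eq_of_norm_sub_lt (differentiable_charFun d cm cp)
    (differentiable_charFun d 0 0) hs
    (fun μ hμ => deriv_charFun_ne_zero hμ (integral_robinSol_neumann_ne_zero hd hμ))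
    (pow_pos hRpos 2) fun μ hμ => ?_
  obtain ⟨l, rfl⟩ : ∃ l, l ^ 2 = μ := ⟨_, cpow_half_sq μ⟩
  rw [norm_pow, pow_left_inj₀ (norm_nonneg _) hRpos.le two_ne_zero] at hμ
  have hl0 : l ≠ 0 := by
    rintro rfl
    rw [norm_zero] at hμ
    exact hRpos.ne hμ
  have hld : ‖l * d‖ = (N + 1 / 2) * Real.pi := by
    rw [norm_mul, hμ, Complex.norm_real, Real.norm_of_nonneg hd.le, sepRadius]
    field_simp
  have hcos := norm_cos_le_two_mul_norm_sin (le_of_max_le_right hN) hld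
  have hsin : 0 < ‖Complex.sin (l * d)‖ := by
    rw [norm_pos_iff]
    intro h
    rw [h, norm_zero, mul_zero] at hcos
    have h1 := Complex.sin_sq_add_cos_sq (l * d)
    rw [h, norm_le_zero_iff.mp hcos] at h1
    norm_num at h1
  have hR := hN₀ N (le_of_max_le_left hN)
  have e1 : charFun d cm cp (l ^ 2) - charFun d 0 0 (l ^ 2)
      = (cm - cp) * Complex.cos (l * d) + cp * cm * (Complex.sin (l * d) / l) := by
    rw [charFun_sq, charFun_sq, sinSol_sq_of_ne hl0]; ring
  have e2 : charFun d 0 0 (l ^ 2) = l * Complex.sin (l * d) := by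
    rw [charFun_sq]; ring
  rw [e1, e2, norm_mul l, hμ]
  have h1R : 1 ≤ sepRadius d N := by
    nlinarith [norm_nonneg (cm - cp), norm_nonneg (cp * cm)]
  have hdiv : ‖Complex.sin (l * d) / l‖ ≤ ‖Complex.sin (l * d)‖ := by
    rw [norm_div, hμ]
    exact div_le_self (norm_nonneg _) h1R
  calc ‖(cm - cp) * Complex.cos (l * d) + cp * cm * (Complex.sin (l * d) / l)‖
      ≤ ‖cm - cp‖ * ‖Complex.cos (l * d)‖ + ‖cp * cm‖ * ‖Complex.sin (l * d) / l‖ := by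
        refine (norm_add_le _ _).trans ?_
        rw [norm_mul (cm - cp), norm_mul (cp * cm)]
    _ ≤ ‖cm - cp‖ * (2 * ‖Complex.sin (l * d)‖) + ‖cp * cm‖ * ‖Complex.sin (l * d)‖ := by
        gcongr
    _ = (2 * ‖cm - cp‖ + ‖cp * cm‖) * ‖Complex.sin (l * d)‖ := by ring
    _ < sepRadius d N * ‖Complex.sin (l * d)‖ := by
        apply mul_lt_mul_of_pos_right _ hsin
        linarith

/-! ### Asymptotics of the eigenvalues and eigenfunctions -/

/-- An enumeration by eventually nondecreasing modulus of a set with `N + 1` points in the disc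
of radius `ρ N`, for all large `N`. -/
lemma norm_enumeration_mem {Z : Set ℂ} {ρ : ℕ → ℝ} (hρ : Tendsto ρ atTop atTop)
    (hc : ∃ N₀ : ℕ, ∀ N ≥ N₀, {z | z ∈ Z ∧ ‖z‖ < ρ N}.ncard = N + 1)
    {lam : ℕ → ℂ} (hinj : Function.Injective lam) (hrange : range lam = Z)
    (hord : ∃ N : ℕ, ∀ m n : ℕ, N ≤ m → m ≤ n → ‖lam m‖ ≤ ‖lam n‖) :
    ∃ M : ℕ, ∀ n ≥ M, ρ n ≤ ‖lam (n + 1)‖ ∧ ‖lam (n + 1)‖ < ρ (n + 1) := by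
  obtain ⟨N₀, hN₀⟩ := hc
  obtain ⟨N₁, hN₁⟩ := hord
  have hev : ∀ᶠ N in atTop, ∀ i ∈ Finset.range N₁, ‖lam i‖ < ρ N := by
    rw [Filter.eventually_all_finset]
    exact fun i _ => hρ.eventually_gt_atTop _
  obtain ⟨M, hM⟩ := eventually_atTop.mp (hev.and (eventually_ge_atTop N₀))
  -- The possibly disordered initial indices already lie in the disc, so the indices inside form an
  -- initial segment of ℕ; having N + 1 elements, it is {0, …, N}.
  have key : ∀ N ≥ M, ∀ n, ‖lam n‖ < ρ N ↔ n ≤ N := by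
    intro N hN
    have hcard : {n | ‖lam n‖ < ρ N}.ncard = N + 1 := by
      rw [← hN₀ N (hM N hN).2, ← Set.ncard_image_of_injective _ hinj]
      congr 1
      ext z
      simp only [mem_image, mem_ofPred_eq, ← hrange, mem_range]
      constructor
      · rintro ⟨n, hn, rfl⟩; exact ⟨⟨n, rfl⟩, hn⟩
      · rintro ⟨⟨n, rfl⟩, hn⟩; exact ⟨n, hn, rfl⟩
    have hfin : {n | ‖lam n‖ < ρ N}.Finite := Set.finite_of_ncard_ne_zero (by omega)
    have hdown : ∀ k n, k ≤ n → ‖lam n‖ < ρ N → ‖lam k‖ < ρ N := by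
      intro k n hkn hn
      by_cases hk : k < N₁
      · exact (hM N hN).1 k (Finset.mem_range.mpr hk)
      · exact (hN₁ k n (not_lt.mp hk) hkn).trans_lt hn
    have hsub : {n | ‖lam n‖ < ρ N} ⊆ Iic N := by
      intro n hn
      have : Iic n ⊆ {n | ‖lam n‖ < ρ N} := fun k hk => hdown k n hk hn
      have := Set.ncard_le_ncard this hfin
      rw [hcard, ← Finset.coe_Iic, Set.ncard_coe_finset, Nat.card_Iic] at this
      exact Nat.succ_le_succ_iff.mp this
    have heq := Set.eq_of_subset_of_ncard_le hsub
      (by rw [hcard, ← Finset.coe_Iic, Set.ncard_coe_finset, Nat.card_Iic]) (finite_Iic N)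
    intro n
    exact Set.ext_iff.mp heq n
  refine ⟨M, fun n hn => ⟨?_, ?_⟩⟩
  · by_contra! h
    exact absurd ((key n hn (n + 1)).mp h) (by omega)
  · exact (key (n + 1) (by omega) (n + 1)).mpr le_rfl

/-- An approximate zero of the sine with modulus near `nπ` is near `nπ`. -/
lemma norm_sub_nat_mul_pi_le {z : ℂ} {ε : ℝ} (n : ℕ) (hε : ε ≤ 1 / 4) (hε0 : 0 ≤ ε)
    (hz : 0 ≤ z.re) (h : ‖Complex.sin z‖ ≤ ε * ‖Complex.cos z‖)
    (h1 : (n - 1 / 2) * Real.pi ≤ ‖z‖) (h2 : ‖z‖ < (n + 1 / 2) * Real.pi) :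
    ‖z - n * Real.pi‖ ≤ 4 * ε := by
  have hsq : ‖Complex.sin z‖ ^ 2 ≤ ε ^ 2 * ‖Complex.cos z‖ ^ 2 := by
    rw [← mul_pow]; exact pow_le_pow_left₀ (norm_nonneg _) h 2
  rw [norm_sin_sq, norm_cos_sq] at hsq
  have hsc := Real.sin_sq_add_cos_sq z.re
  have hsh := sq_le_sinh_sq z.im
  have hee : ε ^ 2 ≤ 1 / 16 := by nlinarith
  -- Since ε² ≤ 1/16, the term ε² sinh² on the right is absorbed on the left.
  have hy2 : z.im ^ 2 ≤ (3 / 2 * ε) ^ 2 := by nlinarith [sq_nonneg (Real.sin z.re)]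
  have hs2 : Real.sin z.re ^ 2 ≤ ε ^ 2 := by
    nlinarith [sq_nonneg (Real.sin z.re), sq_nonneg (Real.sinh z.im)]
  have hy : |z.im| ≤ 3 / 2 * ε := abs_le_of_sq_le_sq hy2 (by positivity)
  have hs : |Real.sin z.re| ≤ ε := abs_le_of_sq_le_sq hs2 hε0
  have hzre : ‖z‖ ≤ z.re + |z.im| := by
    have := Complex.norm_le_abs_re_add_abs_im z
    rwa [abs_of_nonneg hz] at this
  have hre : z.re ≤ ‖z‖ := Complex.re_le_norm z
  set t := z.re - n * Real.pi with ht
  have hst : |Real.sin t| ≤ ε := by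
    have e : |Real.sin t| = |Real.sin z.re| := by
      rw [ht, Real.sin_sub_nat_mul_pi, abs_mul, abs_pow]; simp
    rw [e]; exact hs
  have hpi := Real.pi_gt_three
  have hpi4 := Real.pi_lt_four
  have ht1 : |t| ≤ Real.pi / 2 + 3 / 8 := by
    rw [abs_le]; constructor <;> nlinarith
  have hst' : |Real.sin (|t|)| = |Real.sin t| := by
    rcases abs_choice t with h | h <;> rw [h]
    rw [Real.sin_neg, abs_neg]
  -- For |t| ≤ π/2 Jordan's inequality gives |t| ≤ (π/2)ε. The remaining range has |t| − π/2 ≤ 3/8,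
  -- where sin |t| is far above 1/4 ≥ ε. Together with |Im z| ≤ (3/2)ε this yields 4ε.
  have ht2 : |t| ≤ 2 * ε := by
    by_cases hc : |t| ≤ Real.pi / 2
    · have h3 := Real.mul_le_sin (abs_nonneg t) hc
      have h4 := (le_abs_self (Real.sin (|t|))).trans (hst'.trans_le hst)
      have h5 := h3.trans h4
      have h6 : 2 / Real.pi * |t| = 2 * |t| / Real.pi := by ring
      rw [h6, div_le_iff₀ (by linarith)] at h5
      nlinarith
    · exfalso
      push Not at hc
      have h3 : 1 - (|t| - Real.pi / 2) ^ 2 / 2 ≤ Real.cos (|t| - Real.pi / 2) :=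
        Real.one_sub_sq_div_two_le_cos
      rw [Real.cos_sub_pi_div_two] at h3
      have h4 := (le_abs_self (Real.sin (|t|))).trans (hst'.trans_le hst)
      nlinarith
  have h5 := Complex.norm_le_abs_re_add_abs_im (z - n * Real.pi)
  have e1 : (z - n * Real.pi).re = t := by simp [ht]
  have e2 : (z - n * Real.pi).im = z.im := by simp
  rw [e1, e2] at h5
  linarith

/-- In the characteristic equation |l| ≥ 1 bounds the last term by |c₊c₋| |sin(ld)|, and |l| ≥
2|c₊c₋| lets half of |l| |sin(ld)| absorb it; hence the factor 2. -/
lemma norm_sin_le_of_charFun_eq_zero {d : ℝ} {cm cp l : ℂ} (h : charFun d cm cp (l ^ 2) = 0)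
    (hl : 1 + 2 * ‖cp * cm‖ ≤ ‖l‖) :
    ‖Complex.sin (l * d)‖ ≤ 2 * ‖cm - cp‖ / ‖l‖ * ‖Complex.cos (l * d)‖ := by
  have hl1 : 1 ≤ ‖l‖ := by linarith [norm_nonneg (cp * cm)]
  have hl0 : l ≠ 0 := norm_pos_iff.mp (by linarith)
  rw [charFun_sq, sinSol_sq_of_ne hl0] at h
  have e : l * Complex.sin (l * d)
      = -((cm - cp) * Complex.cos (l * d)) - cp * cm * (Complex.sin (l * d) / l) := by
    linear_combination h
  have h1 : ‖l‖ * ‖Complex.sin (l * d)‖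
      ≤ ‖cm - cp‖ * ‖Complex.cos (l * d)‖ + ‖cp * cm‖ * ‖Complex.sin (l * d)‖ := by
    rw [← norm_mul l, e]
    refine (norm_sub_le _ _).trans ?_
    rw [norm_neg, norm_mul (cm - cp), norm_mul (cp * cm), norm_div]
    gcongr
    exact div_le_self (norm_nonneg _) hl1
  rw [div_mul_eq_mul_div, le_div_iff₀ (by linarith)]
  nlinarith [norm_nonneg (Complex.sin (l * d))]

lemma sqrt_zeros_asymptotic {d : ℝ} (hd : 0 < d) {cm cp : ℂ} {lam : ℕ → ℂ}
    (hz : ∀ n, charFun d cm cp (lam n) = 0)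
    (hb : ∃ M : ℕ, ∀ n ≥ M, sepRadius d n ^ 2 ≤ ‖lam (n + 1)‖ ∧
      ‖lam (n + 1)‖ < sepRadius d (n + 1) ^ 2) :
    ∃ K : ℝ, 0 ≤ K ∧ ∃ M : ℕ, ∀ n ≥ M, ∃ l : ℂ, l ^ 2 = lam n ∧ l ≠ 0 ∧ ‖l‖⁻¹ ≤ K / n ∧
      ‖l * d - n * Real.pi‖ ≤ K / n := by
  obtain ⟨M, hM⟩ := hb
  have hpi := Real.pi_gt_three
  set A := ‖cm - cp‖ with hA
  have hA0 : 0 ≤ A := norm_nonneg _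
  -- 1 + 2|c₊c₋| is the threshold for the sine bound; the term 8A brings its coefficient ε = 2A/|l|
  -- below 1/4.
  obtain ⟨M', hM'⟩ := eventually_atTop.mp
    ((tendsto_sepRadius hd).eventually_ge_atTop (1 + 2 * ‖cp * cm‖ + 8 * A))
  -- The first summand bounds n/|l|, since |l| ≥ (n − 1/2)π/d ≥ n/d; the second is 4ε = 8A/|l| times
  -- n. The `+ 1` accounts for the annuli being stated for the index n + 1.
  refine ⟨d + 8 * A * d, by positivity, max M M' + 1, fun k hk => ?_⟩
  obtain ⟨n, rfl⟩ : ∃ n, k = n + 1 := ⟨k - 1, by omega⟩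
  obtain ⟨h1, h2⟩ := hM n (by omega)
  have hR := hM' n (by omega)
  -- The root in the right half-plane is the one near +nπ/d rather than −nπ/d.
  obtain ⟨l, hl, hre⟩ : ∃ l : ℂ, l ^ 2 = lam (n + 1) ∧ 0 ≤ l.re := by
    obtain ⟨l, hl⟩ : ∃ l, l ^ 2 = lam (n + 1) := ⟨_, cpow_half_sq _⟩
    rcases le_total 0 l.re with h | h
    · exact ⟨l, hl, h⟩
    · exact ⟨-l, by rw [neg_sq, hl], by simpa using h⟩
  rw [← hl, norm_pow] at h1 h2
  have hRp := sepRadius_pos hd n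
  have hRp' := sepRadius_pos hd (n + 1)
  have h1' : sepRadius d n ≤ ‖l‖ := le_of_sq_le_sq h1 (norm_nonneg _)
  have h2' : ‖l‖ < sepRadius d (n + 1) := lt_of_pow_lt_pow_left₀ 2 hRp'.le h2
  have hl0 : 0 < ‖l‖ := hRp.trans_le h1'
  have hinv : ‖l‖⁻¹ ≤ d / ((n + 1 : ℕ) : ℝ) := by
    rw [inv_le_comm₀ hl0 (by positivity), inv_div]
    refine le_trans ?_ h1'
    rw [sepRadius]
    gcongr
    push_cast
    nlinarith [(Nat.cast_nonneg n : (0 : ℝ) ≤ n)]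
  refine ⟨l, hl, norm_pos_iff.mp hl0, hinv.trans ?_, ?_⟩
  · gcongr
    nlinarith
  have hsin := norm_sin_le_of_charFun_eq_zero (d := d) (cm := cm) (cp := cp) (l := l)
    (by rw [hl]; exact hz _) (by linarith)
  have hε : 2 * A / ‖l‖ ≤ 1 / 4 := by
    rw [div_le_iff₀ hl0]
    linarith [norm_nonneg (cp * cm)]
  have hnld : ‖l * d‖ = ‖l‖ * d := by
    rw [norm_mul, Complex.norm_real, Real.norm_of_nonneg hd.le]
  have hfin := norm_sub_nat_mul_pi_le (z := l * d) (n + 1) hε (by positivity)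
    (by simpa using mul_nonneg hre hd.le) hsin
    (by
      rw [hnld]
      rw [sepRadius, div_le_iff₀ hd] at h1'
      push_cast
      linarith)
    (by
      rw [hnld]
      rw [sepRadius, lt_div_iff₀ hd] at h2'
      exact h2')
  refine hfin.trans ?_
  calc 4 * (2 * A / ‖l‖) = 8 * A * ‖l‖⁻¹ := by ring
    _ ≤ 8 * A * (d / ((n + 1 : ℕ) : ℝ)) := by gcongr
    _ = 8 * A * d / ((n + 1 : ℕ) : ℝ) := by ring
    _ ≤ _ := by gcongr; linarith

/-- Here |sin z|² = sin² Re z + sinh² Im z ≤ 1 + (3/2)² < 4. -/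
lemma norm_sin_le_two {z : ℂ} (h : |z.im| ≤ 1) : ‖Complex.sin z‖ ≤ 2 := by
  refine le_of_sq_le_sq ?_ (by norm_num)
  rw [norm_sin_sq]
  have h1 := Real.sin_sq_le_one z.re
  have h2 : |Real.sinh z.im| ≤ Real.sinh 1 := by
    rw [Real.abs_sinh]; exact Real.sinh_le_sinh.mpr h
  have h3 : Real.sinh 1 ≤ 3 / 2 := by
    rw [Real.sinh_eq]
    linarith [Real.exp_one_lt_d9, Real.exp_pos (-1)]
  have h4 : Real.sinh z.im ^ 2 ≤ (3 / 2) ^ 2 := sq_le_sq' (by linarith [(abs_le.mp h2).1])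
    (by linarith [(abs_le.mp h2).2])
  linarith

/-- Mean value inequality on the convex strip |Im z| ≤ 1, where |sin| ≤ 2. -/
lemma norm_cos_sub_cos_le {z w : ℂ} (hz : |z.im| ≤ 1) (hw : |w.im| ≤ 1) :
    ‖Complex.cos z - Complex.cos w‖ ≤ 2 * ‖z - w‖ := by
  have hconv : Convex ℝ {z : ℂ | |z.im| ≤ 1} := by
    have : {z : ℂ | |z.im| ≤ 1} = Complex.imLm ⁻¹' (Icc (-1) 1) := by
      ext z; simp [abs_le]
    rw [this]
    exact (convex_Icc _ _).linear_preimage _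
  refine hconv.norm_image_sub_le_of_norm_deriv_le (𝕜 := ℂ) (f := Complex.cos)
    (fun x _ => Complex.differentiableAt_cos) (fun x hx => ?_) hw hz
  rw [Complex.deriv_cos, norm_neg]
  exact norm_sin_le_two hx

/-- The eigenfunctions approach the Neumann eigenfunctions uniformly, at the rate `1/n`. -/
lemma robinSol_asymptotic {d : ℝ} (hd : 0 < d) {cm cp : ℂ} {lam : ℕ → ℂ}
    (hz : ∀ n, charFun d cm cp (lam n) = 0)
    (hb : ∃ M : ℕ, ∀ n ≥ M, sepRadius d n ^ 2 ≤ ‖lam (n + 1)‖ ∧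
      ‖lam (n + 1)‖ < sepRadius d (n + 1) ^ 2) :
    ∃ K : ℝ, 0 ≤ K ∧ ∃ M : ℕ, ∀ n ≥ M, ∀ y ∈ Icc 0 d,
      ‖robinSol cm (lam n) y - (Real.cos (n * Real.pi / d * y) : ℝ)‖ ≤ K / n := by
  obtain ⟨K, hK, M, hM⟩ := sqrt_zeros_asymptotic hd hz hb
  obtain ⟨M', hM'⟩ := exists_nat_ge K
  -- The Lipschitz bound for the cosine gives 2K; |sin| ≤ 2 with 1/|l| ≤ K/n gives the other term.
  -- Indices beyond M' satisfy K/n ≤ 1, which keeps ly in the strip |Im| ≤ 1.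
  refine ⟨2 * K + ‖cm‖ * (2 * K), by positivity, max M (M' + 1), fun n hn y hy => ?_⟩
  obtain ⟨l, hl, hl0, h1, h2⟩ := hM n (le_of_max_le_left hn)
  have hn0 : (0 : ℝ) < n := by
    have : 0 < n := by have := le_of_max_le_right hn; omega
    exact_mod_cast this
  have hKn : K / n ≤ 1 := by
    rw [div_le_one hn0]
    have : ((M' + 1 : ℕ) : ℝ) ≤ n := by exact_mod_cast le_of_max_le_right hn
    push_cast at this
    linarith
  have hdc : (d : ℂ) ≠ 0 := by exact_mod_cast hd.ne'
  have hdiff : ‖l * y - ((n * Real.pi / d * y : ℝ) : ℂ)‖ ≤ K / n := by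
    have e : l * y - ((n * Real.pi / d * y : ℝ) : ℂ) = (l * d - n * Real.pi) * ((y / d : ℝ) : ℂ) := by
      push_cast; field_simp
    rw [e, norm_mul, Complex.norm_real, Real.norm_of_nonneg (div_nonneg hy.1 hd.le)]
    calc _ ≤ K / n * 1 := by
          exact mul_le_mul h2 ((div_le_one hd).mpr hy.2) (div_nonneg hy.1 hd.le) (by positivity)
      _ = _ := mul_one _
  have him : |(l * y).im| ≤ 1 := by
    have := (Complex.abs_im_le_norm _).trans (hdiff.trans hKn)
    rwa [Complex.sub_im, Complex.ofReal_im, sub_zero] at this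
  have hcos := norm_cos_sub_cos_le him (w := ((n * Real.pi / d * y : ℝ) : ℂ))
    (by rw [Complex.ofReal_im]; simp)
  have hsin := norm_sin_le_two him
  have e : robinSol cm (lam n) y - (Real.cos (n * Real.pi / d * y) : ℝ)
      = (Complex.cos (l * y) - Complex.cos ((n * Real.pi / d * y : ℝ) : ℂ))
        - cm * (Complex.sin (l * y) / l) := by
    rw [robinSol, ← hl, cosSol_sq, sinSol_sq_of_ne hl0, Complex.ofReal_cos]; ring
  rw [e]
  refine (norm_sub_le _ _).trans ?_
  rw [norm_mul, norm_div, div_eq_mul_inv ‖Complex.sin (l * y)‖]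
  calc _ ≤ 2 * (K / n) + ‖cm‖ * (2 * (K / n)) := by
        refine add_le_add (hcos.trans (by gcongr)) ?_
        gcongr
    _ = _ := by ring

/-! ### Primitives of integrable functions and weak derivatives -/

/-- Integration by parts for `θ` of class `C¹` against a primitive of an integrable function. -/
lemma integral_deriv_mul_primitive {b c : ℝ} (hbc : b ≤ c) {h : ℝ → ℂ}
    (hh : IntervalIntegrable h volume b c) {θ θ' : ℝ → ℂ} (hθ : ∀ x, HasDerivAt θ (θ' x) x)
    (hθ' : Continuous θ') :
    ∫ x in b..c, θ' x * ∫ t in b..x, h t = θ c * (∫ t in b..c, h t) - ∫ t in b..c, θ t * h t := by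
  set ν := (volume : Measure ℝ).restrict (Ioc b c) with hν
  have hhi : Integrable h ν := (intervalIntegrable_iff_integrableOn_Ioc_of_le hbc).mp hh
  have hθi : Integrable θ' ν :=
    (intervalIntegrable_iff_integrableOn_Ioc_of_le hbc).mp (hθ'.intervalIntegrable b c)
  -- Fubini on the triangle t ≤ x: integrating the kernel in t gives the left side, in x gives (θ c
  -- − θ t) h t.
  set F : ℝ → ℝ → ℂ := fun x t => {p : ℝ × ℝ | p.2 ≤ p.1}.indicator (fun p => θ' p.1 * h p.2) (x, t)
    with hF
  have hFi : Integrable (Function.uncurry F) (ν.prod ν) :=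
    (hθi.mul_prod hhi).indicator (measurableSet_le measurable_snd measurable_fst)
  have hsw := integral_integral_swap hFi
  have hL : ∫ x, ∫ t, F x t ∂ν ∂ν = ∫ x in b..c, θ' x * ∫ t in b..x, h t := by
    rw [intervalIntegral.integral_of_le hbc]
    refine setIntegral_congr_fun measurableSet_Ioc fun x hx => ?_
    have e : ∀ t, F x t = (Iic x).indicator (fun t => θ' x * h t) t := by
      intro t; simp only [hF, indicator, mem_ofPred_eq, mem_Iic]
    simp only [e]
    rw [integral_indicator measurableSet_Iic, hν, Measure.restrict_restrict measurableSet_Iic,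
      integral_const_mul, intervalIntegral.integral_of_le hx.1.le]
    congr 3
    ext t
    simp only [mem_inter_iff, mem_Iic, mem_Ioc]
    exact ⟨fun h => ⟨h.2.1, h.1⟩, fun h => ⟨h.2, h.1, h.2.trans hx.2⟩⟩
  have hRt : ∫ t, ∫ x, F x t ∂ν ∂ν = ∫ t in b..c, (θ c - θ t) * h t := by
    rw [intervalIntegral.integral_of_le hbc]
    refine setIntegral_congr_fun measurableSet_Ioc fun t ht => ?_
    have e : ∀ x, F x t = (Ici t).indicator (fun x => θ' x * h t) x := by
      intro x; simp only [hF, indicator, mem_ofPred_eq, mem_Ici]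
    simp only [e]
    rw [integral_indicator measurableSet_Ici, hν, Measure.restrict_restrict measurableSet_Ici,
      integral_mul_const]
    congr 1
    rw [← intervalIntegral.integral_eq_sub_of_hasDerivAt (fun x _ => hθ x)
      (hθ'.intervalIntegrable t c), intervalIntegral.integral_of_le ht.2,
      ← integral_Icc_eq_integral_Ioc]
    congr 2
    ext x
    simp only [mem_inter_iff, mem_Ici, mem_Icc, mem_Ioc]
    exact ⟨fun h => ⟨h.1, h.2.2⟩, fun h => ⟨h.1, ht.1.trans_le h.1, h.2⟩⟩
  rw [← hL, hsw, hRt]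
  have hθc : Continuous θ := continuous_iff_continuousAt.mpr fun x => (hθ x).continuousAt
  rw [← intervalIntegral.integral_const_mul, ← intervalIntegral.integral_sub (hh.const_mul _)
    (hh.continuousOn_mul hθc.continuousOn)]
  simp only [sub_mul]

/-- `u` is a primitive on `[-a,a]` of the integrable function `g`. -/
def IsPrimitive (a : ℝ) (u g : ℝ → ℂ) : Prop :=
  IntervalIntegrable g volume (-a) a ∧
    ∀ x ∈ Icc (-a) a, u x = u (-a) + ∫ t in (-a)..x, g t

lemma IsPrimitive.continuousOn {a : ℝ} (ha : 0 < a) {u g : ℝ → ℂ} (h : IsPrimitive a u g) :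
    ContinuousOn u (Icc (-a) a) := by
  have h1 : IntegrableOn g (uIcc (-a) a) := by
    rw [uIcc_of_le (by linarith)]
    exact (intervalIntegrable_iff_integrableOn_Icc_of_le (by linarith)).mp h.1
  have := intervalIntegral.continuousOn_primitive_interval h1
  rw [uIcc_of_le (by linarith)] at this
  exact (continuousOn_const.add this).congr h.2

lemma IsPrimitive.congr {a : ℝ} (ha : 0 < a) {u g g' : ℝ → ℂ} (h : IsPrimitive a u g)
    (hg : g =ᵐ[volume.restrict (Ioo (-a) a)] g') : IsPrimitive a u g' := by
  have hg' : ∀ᵐ x, x ∈ Ioo (-a) a → g x = g' x := (ae_restrict_iff' measurableSet_Ioo).mp hg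
  have hne : ∀ᵐ x : ℝ, x ≠ a := by
    simp [ae_iff, measure_singleton]
  refine ⟨h.1.congr_ae ?_, fun x hx => ?_⟩
  · rw [uIoc_of_le (by linarith), Filter.EventuallyEq, ae_restrict_iff' measurableSet_Ioc]
    filter_upwards [hg', hne] with x h1 h2 h3
    exact h1 ⟨h3.1, lt_of_le_of_ne h3.2 h2⟩
  · rw [h.2 x hx]
    congr 1
    refine intervalIntegral.integral_congr_ae ?_
    filter_upwards [hg', hne] with t h1 h2 h3
    rw [uIoc_of_le hx.1] at h3
    exact h1 ⟨h3.1, lt_of_le_of_ne (h3.2.trans hx.2) h2⟩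

lemma IsPrimitive.intervalIntegrable {a : ℝ} {u g : ℝ → ℂ} (h : IsPrimitive a u g) {x : ℝ}
    (hx : x ∈ Icc (-a) a) : IntervalIntegrable g volume (-a) x :=
  h.1.mono_set (by
    rw [uIcc_of_le hx.1, uIcc_of_le (hx.1.trans hx.2)]
    exact Icc_subset_Icc_right hx.2)

lemma isPrimitive_integral {a : ℝ} {g : ℝ → ℂ} (hg : IntervalIntegrable g volume (-a) a) :
    IsPrimitive a (fun x => ∫ t in (-a)..x, g t) g :=
  ⟨hg, fun x _ => by simp⟩

lemma isPrimitive_of_hasDerivAt {a : ℝ} {u g : ℝ → ℂ} (hu : ∀ x, HasDerivAt u (g x) x)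
    (hg : Continuous g) : IsPrimitive a u g :=
  ⟨hg.intervalIntegrable _ _, fun x _ => by
    rw [intervalIntegral.integral_eq_sub_of_hasDerivAt (fun x _ => hu x) (hg.intervalIntegrable _ _)]
    ring⟩

lemma IsPrimitive.neg {a : ℝ} {u g : ℝ → ℂ} (h : IsPrimitive a u g) :
    IsPrimitive a (fun x => -u x) (fun x => -g x) :=
  ⟨h.1.neg, fun x hx => by beta_reduce; rw [h.2 x hx, intervalIntegral.integral_neg]; ring⟩

lemma IsPrimitive.add {a : ℝ} {u g u' g' : ℝ → ℂ} (h : IsPrimitive a u g)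
    (h' : IsPrimitive a u' g') : IsPrimitive a (fun x => u x + u' x) (fun x => g x + g' x) :=
  ⟨h.1.add h'.1, fun x hx => by
    beta_reduce
    rw [h.2 x hx, h'.2 x hx, intervalIntegral.integral_add (h.intervalIntegrable hx)
      (h'.intervalIntegrable hx)]
    ring⟩

lemma IsPrimitive.sub {a : ℝ} {u g u' g' : ℝ → ℂ} (h : IsPrimitive a u g)
    (h' : IsPrimitive a u' g') : IsPrimitive a (fun x => u x - u' x) (fun x => g x - g' x) := by
  simpa only [sub_eq_add_neg] using h.add h'.neg

/-- Integration by parts on `[-a,x]`. -/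
lemma IsPrimitive.integral_deriv_mul {a : ℝ} (ha : 0 < a) {u g : ℝ → ℂ} (h : IsPrimitive a u g)
    {θ θ' : ℝ → ℂ} (hθ : ∀ x, HasDerivAt θ (θ' x) x) (hθ' : Continuous θ') {x : ℝ}
    (hx : x ∈ Icc (-a) a) :
    ∫ t in (-a)..x, θ' t * u t = θ x * u x - θ (-a) * u (-a) - ∫ t in (-a)..x, θ t * g t := by
  have hgi := h.intervalIntegrable hx
  have hsub : uIcc (-a) x ⊆ Icc (-a) a := by
    rw [uIcc_of_le hx.1]; exact Icc_subset_Icc_right hx.2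
  have e : ∫ t in (-a)..x, θ' t * u t
      = ∫ t in (-a)..x, (θ' t * u (-a) + θ' t * ∫ s in (-a)..t, g s) := by
    refine intervalIntegral.integral_congr fun t ht => ?_
    rw [h.2 t (hsub ht)]; ring
  have hP : ContinuousOn (fun t => ∫ s in (-a)..t, g s) (uIcc (-a) x) :=
    ((isPrimitive_integral h.1).continuousOn ha).mono hsub
  have i1 : IntervalIntegrable (fun t => θ' t * u (-a)) volume (-a) x :=
    (by fun_prop : Continuous fun t => θ' t * u (-a)).intervalIntegrable _ _
  have i2 : IntervalIntegrable (fun t => θ' t * ∫ s in (-a)..t, g s) volume (-a) x :=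
    (hθ'.continuousOn.mul hP).intervalIntegrable
  rw [e, intervalIntegral.integral_add i1 i2, integral_deriv_mul_primitive hx.1 hgi hθ hθ',
    intervalIntegral.integral_mul_const, intervalIntegral.integral_eq_sub_of_hasDerivAt
    (fun x _ => hθ x) (hθ'.intervalIntegrable _ _), h.2 x hx]
  ring

lemma IsPrimitive.mul {a : ℝ} (ha : 0 < a) {u g : ℝ → ℂ} (h : IsPrimitive a u g)
    {θ θ' : ℝ → ℂ} (hθ : ∀ x, HasDerivAt θ (θ' x) x) (hθ' : Continuous θ') :
    IsPrimitive a (fun x => θ x * u x) (fun x => θ' x * u x + θ x * g x) := by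
  have hθc : Continuous θ := continuous_iff_continuousAt.mpr fun x => (hθ x).continuousAt
  have i1 : ∀ x ∈ Icc (-a) a, IntervalIntegrable (fun t => θ' t * u t) volume (-a) x := by
    intro x hx
    refine (hθ'.continuousOn.mul ((h.continuousOn ha).mono ?_)).intervalIntegrable
    rw [uIcc_of_le hx.1]; exact Icc_subset_Icc_right hx.2
  have i2 : ∀ x ∈ Icc (-a) a, IntervalIntegrable (fun t => θ t * g t) volume (-a) x :=
    fun x hx => (h.intervalIntegrable hx).continuousOn_mul hθc.continuousOn
  have haa : a ∈ Icc (-a) a := right_mem_Icc.mpr (by linarith)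
  refine ⟨(i1 a haa).add (i2 a haa), fun x hx => ?_⟩
  rw [intervalIntegral.integral_add (i1 x hx) (i2 x hx), h.integral_deriv_mul ha hθ hθ' hx]
  ring

lemma IsPrimitive.const_of_eq_zero {a : ℝ} (ha : 0 < a) {u g : ℝ → ℂ} (h : IsPrimitive a u g)
    (hg : ∀ x ∈ Ioo (-a) a, g x = 0) {x : ℝ} (hx : x ∈ Icc (-a) a) : u x = u (-a) := by
  have := h.congr ha (g' := fun _ => 0)
    ((ae_restrict_iff' measurableSet_Ioo).mpr (Eventually.of_forall hg))
  rw [this.2 x hx]; simp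

lemma integral_Ioo_eq_intervalIntegral {a : ℝ} (ha : 0 < a) (f : ℝ → ℂ) :
    ∫ x in Ioo (-a) a, f x = ∫ x in (-a)..a, f x := by
  rw [intervalIntegral.integral_of_le (by linarith), integral_Ioc_eq_integral_Ioo]

lemma intervalIntegrable_L2 {a : ℝ} (ha : 0 < a) (g : L2 a) :
    IntervalIntegrable g volume (-a) a := by
  rw [intervalIntegrable_iff_integrableOn_Ioo_of_le (by linarith)]
  exact (Lp.memLp g).integrable (by norm_num)

/-- A primitive is weakly differentiable. -/
lemma IsPrimitive.hasWeakDeriv {a : ℝ} (ha : 0 < a) {u g : ℝ → ℂ} (h : IsPrimitive a u g)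
    {ψ ψ₁ : L2 a} (hψ : ψ =ᵐ[volume.restrict (Ioo (-a) a)] u)
    (hψ₁ : ψ₁ =ᵐ[volume.restrict (Ioo (-a) a)] g) : HasWeakDeriv a ψ ψ₁ := by
  intro η h1 h2 h3
  have hz : ∀ x, x ∉ Ioo (-a) a → η x = 0 := fun x hx =>
    image_eq_zero_of_notMem_tsupport fun hx' => hx (h3 hx')
  have hη : ∀ x, HasDerivAt (fun x => (η x : ℂ)) ((deriv η x : ℝ) : ℂ) x := fun x =>
    ((h1.differentiable (by simp)) x).hasDerivAt.ofReal_comp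
  have hc : Continuous fun x => ((deriv η x : ℝ) : ℂ) :=
    Complex.continuous_ofReal.comp (h1.continuous_deriv (by simp))
  have key := h.integral_deriv_mul ha hη hc (x := a) (right_mem_Icc.mpr (by linarith))
  rw [hz a (by simp), hz (-a) (by simp)] at key
  have e1 : ∫ x in Ioo (-a) a, deriv η x • ψ x = ∫ t in (-a)..a, ((deriv η t : ℝ) : ℂ) * u t := by
    rw [← integral_Ioo_eq_intervalIntegral ha]
    refine integral_congr_ae ?_
    filter_upwards [hψ] with x hx
    rw [hx, Complex.real_smul]
  have e2 : ∫ x in Ioo (-a) a, η x • ψ₁ x = ∫ t in (-a)..a, (η t : ℂ) * g t := by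
    rw [← integral_Ioo_eq_intervalIntegral ha]
    refine integral_congr_ae ?_
    filter_upwards [hψ₁] with x hx
    rw [hx, Complex.real_smul]
  rw [e1, e2, key]
  simp

/-- Continuous functions that agree almost everywhere on `(-a,a)` agree on `[-a,a]`. -/
lemma eqOn_Icc_of_ae_eq {a : ℝ} (ha : 0 < a) {u v : ℝ → ℂ} (hu : ContinuousOn u (Icc (-a) a))
    (hv : ContinuousOn v (Icc (-a) a)) (h : u =ᵐ[volume.restrict (Ioo (-a) a)] v) :
    EqOn u v (Icc (-a) a) := by
  rw [restrict_Ioo_eq_restrict_Icc] at h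
  exact Measure.eqOn_Icc_of_ae_eq volume (by linarith) h hu hv

/-- The lemma of du Bois-Reymond: a continuous function with vanishing weak derivative is
constant. -/
lemma const_of_weak_deriv_zero {a : ℝ} (ha : 0 < a) {w : ℝ → ℂ}
    (hw : ContinuousOn w (Icc (-a) a))
    (h : ∀ η : ℝ → ℝ, ContDiff ℝ ∞ η → HasCompactSupport η → tsupport η ⊆ Ioo (-a) a →
      ∫ x in Ioo (-a) a, deriv η x • w x = 0) : ∃ c : ℂ, ∀ x ∈ Icc (-a) a, w x = c := by
  set b : ContDiffBump (0 : ℝ) := ⟨a / 3, a / 2, by positivity, by linarith⟩ with hb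
  set η₀ : ℝ → ℝ := b.normed volume with hη₀
  have hη₀s : tsupport η₀ ⊆ Ioo (-a) a := by
    rw [hη₀, b.tsupport_normed_eq, Real.closedBall_eq_Icc]
    exact fun x hx => ⟨by have := hx.1; simp only [hb] at this; linarith,
      by have := hx.2; simp only [hb] at this; linarith⟩
  have hη₀d : ContDiff ℝ ∞ η₀ := b.contDiff_normed
  have hη₀c : HasCompactSupport η₀ := b.hasCompactSupport_normed
  have hη₀i : ∫ x, η₀ x = 1 := b.integral_normed
  have hwi : Integrable w (volume.restrict (Ioo (-a) a)) :=
    (hw.integrableOn_Icc).mono_set Ioo_subset_Icc_self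
  have hmul : ∀ η : ℝ → ℝ, Continuous η → HasCompactSupport η →
      Integrable (fun x => η x • w x) (volume.restrict (Ioo (-a) a)) := by
    intro η hη hc
    obtain ⟨C, hC⟩ := hη.bounded_above_of_compact_support hc
    exact hwi.bdd_smul C hη.aestronglyMeasurable (Eventually.of_forall hC)
  set c : ℂ := ∫ x in Ioo (-a) a, η₀ x • w x with hc
  have key : ∀ η : ℝ → ℝ, ContDiff ℝ ∞ η → HasCompactSupport η → tsupport η ⊆ Ioo (-a) a →
      ∫ x in Ioo (-a) a, η x • w x = (∫ x, η x) • c := by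
    intro η h1 h2 h3
    set m := ∫ x, η x with hm
    -- Subtracting m η₀ makes the mean zero, so the primitive of κ is again a test function and the
    -- hypothesis applies to it.
    set κ : ℝ → ℝ := fun x => η x - m * η₀ x with hκ
    have hκd : ContDiff ℝ ∞ κ := h1.sub (contDiff_const.mul hη₀d)
    have hκc : Continuous κ := hκd.continuous
    have hi1 : Integrable η := h1.continuous.integrable_of_hasCompactSupport h2
    have hi2 : Integrable η₀ := hη₀d.continuous.integrable_of_hasCompactSupport hη₀c
    have hκi : ∫ x, κ x = 0 := by
      rw [hκ, integral_sub hi1 (hi2.const_mul m), integral_const_mul, hη₀i]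
      simp [hm]
    set K : Set ℝ := tsupport η ∪ tsupport η₀ with hK
    have hKc : IsCompact K := h2.isCompact.union hη₀c.isCompact
    have hKs : K ⊆ Ioo (-a) a := union_subset h3 hη₀s
    have hKne : K.Nonempty := by
      refine ⟨0, Or.inr ?_⟩
      rw [hη₀, b.tsupport_normed_eq]
      exact Metric.mem_closedBall_self b.rOut_pos.le
    obtain ⟨p, hpK, hp⟩ := hKc.exists_isLeast hKne
    obtain ⟨q, hqK, hq⟩ := hKc.exists_isGreatest hKne
    have hκz : ∀ x, x ∉ Icc p q → κ x = 0 := by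
      intro x hx
      have hxK : x ∉ K := fun h => hx ⟨hp h, hq h⟩
      have e1 : η x = 0 := image_eq_zero_of_notMem_tsupport fun h => hxK (Or.inl h)
      have e2 : η₀ x = 0 := image_eq_zero_of_notMem_tsupport fun h => hxK (Or.inr h)
      simp [hκ, e1, e2]
    have hκint : Integrable κ := hi1.sub (hi2.const_mul m)
    set θ : ℝ → ℝ := fun x => ∫ t in (-a)..x, κ t with hθ
    have hθd : ∀ x, HasDerivAt θ (κ x) x := fun x =>
      intervalIntegral.integral_hasDerivAt_right (hκc.intervalIntegrable _ _)
        (hκc.stronglyMeasurableAtFilter _ _) hκc.continuousAt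
    have hθz : ∀ x, x ∉ Icc p q → θ x = 0 := by
      intro x hx
      rw [mem_Icc, not_and_or, not_le, not_le] at hx
      rcases hx with hx | hx
      · refine (intervalIntegral.integral_congr (g := fun _ => (0 : ℝ)) fun t ht => ?_).trans (by simp)
        refine hκz t fun h => ?_
        have h5 := ht.2
        have : -a < p := (hKs hpK).1
        rcases le_total (-a) x with h6 | h6
        · rw [max_eq_right h6] at h5; linarith [h.1]
        · rw [max_eq_left h6] at h5; linarith [h.1]
      · have h6 : -a < p := (hKs hpK).1
        have hpq : p ≤ q := hp hqK
        have : ∫ t in (-a)..x, κ t = ∫ t, κ t := by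
          rw [intervalIntegral.integral_of_le (by linarith)]
          refine setIntegral_eq_integral_of_forall_compl_eq_zero fun t ht => hκz t fun h => ?_
          exact ht ⟨by linarith [h.1], by linarith [h.2]⟩
        exact this.trans hκi
    have hts : tsupport θ ⊆ Icc p q :=
      closure_minimal (fun x hx => by
        by_contra h
        exact hx (hθz x h)) isClosed_Icc
    have hderiv : deriv θ = κ := funext fun x => (hθd x).deriv
    have hθs : ContDiff ℝ ∞ θ := by
      rw [contDiff_infty_iff_deriv, hderiv]
      exact ⟨fun x => (hθd x).differentiableAt, hκd⟩
    have := h θ hθs (HasCompactSupport.of_support_subset_isCompact isCompact_Icc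
      ((subset_tsupport θ).trans hts)) (hts.trans fun x hx =>
        ⟨(hKs hpK).1.trans_le hx.1, hx.2.trans_lt (hKs hqK).2⟩)
    rw [hderiv] at this
    have e : ∀ x, κ x • w x = η x • w x - m • (η₀ x • w x) := by
      intro x
      simp only [hκ, sub_smul, mul_smul]
    simp only [e] at this
    have i2 : Integrable (fun x => m • η₀ x • w x) (volume.restrict (Ioo (-a) a)) :=
      (hmul η₀ hη₀d.continuous hη₀c).smul m
    rw [integral_sub (hmul η h1.continuous h2) i2, integral_smul, sub_eq_zero] at this
    exact this
  have hwci : IntegrableOn (fun x => w x - c) (Ioo (-a) a) := hwi.sub (integrable_const c)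
  have hae := (isOpen_Ioo (a := -a) (b := a)).ae_eq_zero_of_integral_contDiff_smul_eq_zero
    (f := fun x => w x - c) (μ := volume)
    hwci.locallyIntegrableOn (by
      intro η h1 h2 h3
      have hz : ∀ x, x ∉ Ioo (-a) a → η x = 0 := fun x hx =>
        image_eq_zero_of_notMem_tsupport fun hx' => hx (h3 hx')
      rw [← setIntegral_eq_integral_of_forall_compl_eq_zero (s := Ioo (-a) a)
        (fun x hx => by rw [hz x hx, zero_smul])]
      simp only [smul_sub]
      have hi1 : Integrable η := h1.continuous.integrable_of_hasCompactSupport h2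
      rw [integral_sub (hmul η h1.continuous h2) (hi1.restrict.smul_const c), key η h1 h2 h3,
        integral_smul_const, setIntegral_eq_integral_of_forall_compl_eq_zero hz, sub_self])
  refine ⟨c, eqOn_Icc_of_ae_eq ha hw continuousOn_const ?_⟩
  rw [Filter.EventuallyEq, ae_restrict_iff' measurableSet_Ioo]
  filter_upwards [hae] with x hx hx'
  exact sub_eq_zero.mp (hx hx')

/-- The continuous representative of a weakly differentiable class is a primitive of the weak
derivative. -/
lemma HasWeakDeriv.isPrimitive {a : ℝ} (ha : 0 < a) {ψ g : L2 a} (h : HasWeakDeriv a ψ g)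
    {u : ℝ → ℂ} (hu : IsContRep a ψ u) : IsPrimitive a u g := by
  have hgi := intervalIntegrable_L2 ha g
  have hP := isPrimitive_integral hgi
  -- The representative and the primitive of g have the same weak derivative, so they differ by a
  -- constant.
  obtain ⟨c, hc⟩ := const_of_weak_deriv_zero ha (w := fun x => u x - ∫ t in (-a)..x, g t)
    (hu.1.sub (hP.continuousOn ha)) (by
      intro η h1 h2 h3
      have hPm : MemLp (fun x => ∫ t in (-a)..x, g t) 2 (volume.restrict (Ioo (-a) a)) := by
        obtain ⟨C, hC⟩ := isCompact_Icc.exists_bound_of_continuousOn (hP.continuousOn ha)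
        refine MemLp.of_bound (((hP.continuousOn ha).mono
          Ioo_subset_Icc_self).aestronglyMeasurable measurableSet_Ioo) C ?_
        exact (ae_restrict_iff' measurableSet_Ioo).mpr
          (Eventually.of_forall fun x hx => hC x (Ioo_subset_Icc_self hx))
      set p : L2 a := hPm.toLp with hp
      have hw := hP.hasWeakDeriv ha (ψ := p) hPm.coeFn_toLp (EventuallyEq.refl _ _) η h1 h2 h3
      have hd : Continuous (deriv η) := h1.continuous_deriv (by simp)
      have e : ∫ x in Ioo (-a) a, deriv η x • (u x - ∫ t in (-a)..x, g t)
          = ∫ x in Ioo (-a) a, (deriv η x • ψ x - deriv η x • p x) := by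
        refine integral_congr_ae ?_
        filter_upwards [hu.2, hPm.coeFn_toLp] with x h5 h6
        rw [h5, h6, smul_sub]
      rw [e, integral_sub (integrable_test ψ hd h2.deriv) (integrable_test _ hd h2.deriv),
        h η h1 h2 h3, hw, sub_self])
  refine ⟨hgi, fun x hx => ?_⟩
  have h1 := hc x hx
  have h2 := hc (-a) (left_mem_Icc.mpr (by linarith))
  simp only [intervalIntegral.integral_same, sub_zero] at h1 h2
  rw [h2, ← h1]; ring

/-! ### Eigenfunctions, the range of H − μ, and algebraic simplicity -/

lemma memLp_of_continuousOn {a : ℝ} {u : ℝ → ℂ} (hu : ContinuousOn u (Icc (-a) a)) :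
    MemLp u 2 (volume.restrict (Ioo (-a) a)) := by
  obtain ⟨C, hC⟩ := isCompact_Icc.exists_bound_of_continuousOn hu
  refine MemLp.of_bound ((hu.mono Ioo_subset_Icc_self).aestronglyMeasurable measurableSet_Ioo) C ?_
  exact (ae_restrict_iff' measurableSet_Ioo).mpr
    (Eventually.of_forall fun x hx => hC x (Ioo_subset_Icc_self hx))

/-- The class in `L²(-a,a)` of a function continuous on `[-a,a]`. -/
def toL2 {a : ℝ} {u : ℝ → ℂ} (hu : ContinuousOn u (Icc (-a) a)) : L2 a :=
  (memLp_of_continuousOn hu).toLp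

lemma coeFn_toL2 {a : ℝ} {u : ℝ → ℂ} (hu : ContinuousOn u (Icc (-a) a)) :
    toL2 hu =ᵐ[volume.restrict (Ioo (-a) a)] u :=
  (memLp_of_continuousOn hu).coeFn_toLp

lemma isContRep_toL2 {a : ℝ} {u : ℝ → ℂ} (hu : ContinuousOn u (Icc (-a) a)) :
    IsContRep a (toL2 hu) u := ⟨hu, coeFn_toL2 hu⟩

lemma inner_eq_intervalIntegral {a : ℝ} (ha : 0 < a) (f g : L2 a) :
    inner ℂ f g = ∫ x in (-a)..a, conj (f x) * g x := by
  rw [MeasureTheory.L2.inner_def, ← integral_Ioo_eq_intervalIntegral ha]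
  simp only [RCLike.inner_apply, mul_comm]

lemma inner_toL2_left {a : ℝ} (ha : 0 < a) {u : ℝ → ℂ} (hu : ContinuousOn u (Icc (-a) a))
    (g : L2 a) : inner ℂ (toL2 hu) g = ∫ x in (-a)..a, conj (u x) * g x := by
  rw [inner_eq_intervalIntegral ha, ← integral_Ioo_eq_intervalIntegral ha,
    ← integral_Ioo_eq_intervalIntegral ha]
  refine integral_congr_ae ?_
  filter_upwards [coeFn_toL2 hu] with x hx
  rw [hx]

lemma hasDerivAt_comp_add {θ : ℝ → ℂ} {θ' : ℝ → ℂ} (h : ∀ y, HasDerivAt θ (θ' y) y) (a x : ℝ) :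
    HasDerivAt (fun x => θ (x + a)) (θ' (x + a)) x := by
  have := HasDerivAt.scomp x (h (x + a)) ((hasDerivAt_id x).add_const a)
  simpa [Function.comp_def] using this

lemma continuous_robinSol_comp (c μ : ℂ) (a : ℝ) : Continuous fun x => robinSol c μ (x + a) := by
  fun_prop

/-- The class of the solution of `-u'' = μ u` with `u(-a) = 1`, `u'(-a) = -c`. -/
def robinMode (a : ℝ) (c μ : ℂ) : L2 a :=
  toL2 (continuous_robinSol_comp c μ a).continuousOn

lemma coeFn_robinMode (a : ℝ) (c μ : ℂ) :
    robinMode a c μ =ᵐ[volume.restrict (Ioo (-a) a)] fun x => robinSol c μ (x + a) :=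
  coeFn_toL2 _

lemma robinMode_ne_zero {a : ℝ} (ha : 0 < a) (c μ : ℂ) : robinMode a c μ ≠ 0 := by
  intro h
  have h1 := coeFn_robinMode a c μ
  rw [h] at h1
  have h2 := eqOn_Icc_of_ae_eq ha (continuous_robinSol_comp c μ a).continuousOn
    (continuousOn_const (c := (0 : ℂ)))
    (h1.symm.trans (Lp.coeFn_zero ℂ 2 (volume.restrict (Ioo (-a) a))))
  have h3 := h2 (left_mem_Icc.mpr (by linarith : -a ≤ a))
  simp at h3

lemma charFun_two_mul (a : ℝ) {cm cp μ : ℂ} (h : charFun (2 * a) cm cp μ = 0) :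
    robinSol' cm μ (a + a) + cp * robinSol cm μ (a + a) = 0 := by
  rw [charFun_eq, two_mul, neg_eq_zero] at h
  exact h

/-- At a zero of the characteristic function, `robinMode` is an eigenfunction. -/
lemma robinMode_isEigenvector {a : ℝ} (ha : 0 < a) {cm cp μ : ℂ}
    (h : charFun (2 * a) cm cp μ = 0) :
    IsEigenvector (robin a cm cp) μ (robinMode a cm μ) := by
  have hc' : Continuous fun x => robinSol' cm μ (x + a) := by fun_prop
  set ψ := robinMode a cm μ with hψ
  set ψ₁ : L2 a := toL2 hc'.continuousOn with hψ₁
  have h1 : HasWeakDeriv a ψ ψ₁ :=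
    (isPrimitive_of_hasDerivAt (hasDerivAt_comp_add (hasDerivAt_robinSol cm μ) a) hc').hasWeakDeriv
      ha (coeFn_robinMode a cm μ) (coeFn_toL2 _)
  have h2 : HasWeakDeriv a ψ₁ (-μ • ψ) := by
    refine (isPrimitive_of_hasDerivAt (hasDerivAt_comp_add (hasDerivAt_robinSol' cm μ) a)
      (by fun_prop)).hasWeakDeriv ha (coeFn_toL2 _) ?_
    filter_upwards [Lp.coeFn_smul (-μ) ψ, coeFn_robinMode a cm μ] with x e1 e2
    rw [e1, Pi.smul_apply, e2, smul_eq_mul]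
  have hdom : ψ ∈ robinDomain a cm cp := by
    refine ⟨ψ₁, -μ • ψ, ⟨h1, h2⟩, _, _, isContRep_toL2 _, isContRep_toL2 _, ?_, ?_⟩
    · exact charFun_two_mul a h
    · simp
  refine ⟨robinMode_ne_zero ha cm μ, ⟨ψ, hdom⟩, rfl, ?_⟩
  rw [robin_apply _ ⟨h1, h2⟩, neg_smul, neg_neg]

/-- At an eigenvalue `μ`, the range of `H - μ` contains every `g` with `∫ u g = 0`, where `u` is the
eigenfunction. -/
lemma exists_robin_sub_eq {a : ℝ} (ha : 0 < a) {cm cp μ : ℂ} (h : charFun (2 * a) cm cp μ = 0)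
    {g : L2 a} (hg : ∫ x in (-a)..a, robinSol cm μ (x + a) * g x = 0) :
    ∃ χ : (robin a cm cp).domain, robin a cm cp χ - μ • (χ : L2 a) = g := by
  have hgi := intervalIntegrable_L2 ha g
  set C : ℝ → ℂ := fun x => cosSol μ (x + a) with hC
  set S : ℝ → ℂ := fun x => sinSol μ (x + a) with hS
  have hCc : Continuous C := by fun_prop
  have hSc : Continuous S := by fun_prop
  have hCd : ∀ x, HasDerivAt C (-μ * S x) x := hasDerivAt_comp_add (hasDerivAt_cosSol μ) a
  have hSd : ∀ x, HasDerivAt S (C x) x := hasDerivAt_comp_add (hasDerivAt_sinSol μ) a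
  have hCg : IntervalIntegrable (fun x => C x * g x) volume (-a) a :=
    hgi.continuousOn_mul hCc.continuousOn
  have hSg : IntervalIntegrable (fun x => S x * g x) volume (-a) a :=
    hgi.continuousOn_mul hSc.continuousOn
  set p : ℝ → ℂ := fun x => ∫ t in (-a)..x, C t * g t with hp
  set q : ℝ → ℂ := fun x => ∫ t in (-a)..x, S t * g t with hq
  have hpp : IsPrimitive a p (fun x => C x * g x) := isPrimitive_integral hCg
  have hqp : IsPrimitive a q (fun x => S x * g x) := isPrimitive_integral hSg
  have hone : ∀ x, C x ^ 2 + μ * S x ^ 2 = 1 := fun x => cosSol_sq_add μ (x + a)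
  -- Variation of constants: X solves −X'' − μX = g with zero Cauchy data at −a, so the left
  -- boundary condition is automatic, and V is X'.
  set X : ℝ → ℂ := fun x => C x * q x - S x * p x with hX
  set V : ℝ → ℂ := fun x => -(C x * p x + μ * S x * q x) with hV
  have hXV : IsPrimitive a X V := by
    refine ((hqp.mul ha hCd (by fun_prop)).sub (hpp.mul ha hSd hCc)).congr ha
      (Eventually.of_forall fun x => ?_)
    simp only [hV]; ring
  have hVg : IsPrimitive a V (fun x => -g x - μ * X x) := by
    have hμS : ∀ x, HasDerivAt (fun x => μ * S x) (μ * C x) x := fun x => (hSd x).const_mul μ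
    refine (((hpp.mul ha hCd (by fun_prop)).add (hqp.mul ha hμS (by fun_prop))).neg).congr ha
      (Eventually.of_forall fun x => ?_)
    simp only [hX]
    linear_combination (-g x) * hone x
  have hXc := hXV.continuousOn ha
  have hVc := hVg.continuousOn ha
  set χ := toL2 hXc with hχ
  have h1 : HasWeakDeriv a χ (toL2 hVc) := hXV.hasWeakDeriv ha (coeFn_toL2 _) (coeFn_toL2 _)
  have h2 : HasWeakDeriv a (toL2 hVc) (-g - μ • χ) := by
    refine hVg.hasWeakDeriv ha (coeFn_toL2 _) ?_
    filter_upwards [Lp.coeFn_sub (-g) (μ • χ), Lp.coeFn_neg g, Lp.coeFn_smul μ χ, coeFn_toL2 hXc]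
      with x e1 e2 e3 e4
    rw [e1, Pi.sub_apply, e2, Pi.neg_apply, e3, Pi.smul_apply, e4, smul_eq_mul]
  -- This is the orthogonality hypothesis on g; together with F(μ) = 0 it yields the right boundary
  -- condition.
  have hpq : p a - cm * q a = 0 := by
    rw [← hg, hp, hq]
    simp only
    rw [← intervalIntegral.integral_const_mul, ← intervalIntegral.integral_sub hCg
      (hSg.const_mul cm)]
    refine intervalIntegral.integral_congr fun x _ => ?_
    simp only [robinSol, hC, hS]; ring
  have hdom : χ ∈ robinDomain a cm cp := by
    refine ⟨toL2 hVc, -g - μ • χ, ⟨h1, h2⟩, X, V, isContRep_toL2 _, isContRep_toL2 _, ?_, ?_⟩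
    · have hF : μ * S a + (cm - cp) * C a + cp * cm * S a = 0 := by
        rw [charFun, two_mul] at h; exact h
      simp only [hX, hV]
      linear_combination (-(C a + cp * S a)) * hpq - q a * hF
    · simp [hX, hV, hp, hq]
  refine ⟨⟨χ, hdom⟩, ?_⟩
  rw [robin_apply _ ⟨h1, h2⟩]
  simp only
  abel

/-- Constancy of the Wronskian of two solutions of `-u'' = μ u`. -/
lemma wronskian_const {a : ℝ} (ha : 0 < a) {μ : ℂ} {u v θ θ' : ℝ → ℂ} (huv : IsPrimitive a u v)
    (hv : IsPrimitive a v (fun x => -μ * u x)) (hθ : ∀ x, HasDerivAt θ (θ' x) x)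
    (hθ' : ∀ x, HasDerivAt θ' (-μ * θ x) x) {x : ℝ} (hx : x ∈ Icc (-a) a) :
    θ' x * u x - θ x * v x = θ' (-a) * u (-a) - θ (-a) * v (-a) := by
  have hθc : Continuous θ := continuous_iff_continuousAt.mpr fun x => (hθ x).continuousAt
  have hθc' : Continuous θ' := continuous_iff_continuousAt.mpr fun x => (hθ' x).continuousAt
  refine ((huv.mul ha hθ' (by fun_prop)).sub (hv.mul ha hθ hθc')).const_of_eq_zero ha
    (fun x _ => ?_) hx
  ring

/-- Eigenvalues are zeros of the characteristic function. -/
lemma charFun_eq_zero_of_isEigenvalue {a : ℝ} (ha : 0 < a) {cm cp μ : ℂ}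
    (h : IsEigenvalue (robin a cm cp) μ) : charFun (2 * a) cm cp μ = 0 := by
  obtain ⟨x, hx0, y, rfl, hy⟩ := h
  obtain ⟨ψ₁, ψ₂, ⟨h1, h2⟩, u, v, hu, hv, hbp, hbm⟩ := y.2
  rw [robin_apply y ⟨h1, h2⟩, neg_eq_iff_eq_neg] at hy
  have huv : IsPrimitive a u v := (h1.isPrimitive ha hu).congr ha hv.2
  have hvu : IsPrimitive a v (fun x => -μ * u x) := by
    refine (h2.isPrimitive ha hv).congr ha ?_
    rw [hy]
    filter_upwards [Lp.coeFn_neg (μ • (y : L2 a)), Lp.coeFn_smul μ (y : L2 a), hu.2] with x e1 e2 e3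
    rw [e1, Pi.neg_apply, e2, Pi.smul_apply, e3, smul_eq_mul, neg_mul]
  have haa : a ∈ Icc (-a) a := right_mem_Icc.mpr (by linarith)
  -- The Wronskian with `robinSol` vanishes by the left boundary condition; with the right one this
  -- gives F(μ) u(a) = 0. If F(μ) ≠ 0, then u has zero Cauchy data at a and is identically zero.
  by_contra hF
  have w1 := wronskian_const ha huv hvu (hasDerivAt_comp_add (hasDerivAt_robinSol cm μ) a)
    (hasDerivAt_comp_add (hasDerivAt_robinSol' cm μ) a) haa
  simp only [neg_add_cancel, robinSol_zero, robinSol'_zero] at w1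
  have hua : u a = 0 := by
    have e : charFun (2 * a) cm cp μ * u a = 0 := by
      rw [charFun_eq, two_mul]
      linear_combination (-1 : ℂ) * w1 + (-robinSol cm μ (a + a)) * hbp + hbm
    exact (mul_eq_zero.mp e).resolve_left hF
  have hva : v a = 0 := by rw [hua] at hbp; simpa using hbp
  have hCd := hasDerivAt_comp_add (hasDerivAt_cosSol μ) a
  have hSd := hasDerivAt_comp_add (hasDerivAt_sinSol μ) a
  have hCd' : ∀ x, HasDerivAt (fun x => -μ * sinSol μ (x + a)) (-μ * cosSol μ (x + a)) x :=
    fun x => (hSd x).const_mul (-μ)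
  have hu0 : ∀ x ∈ Icc (-a) a, u x = 0 := by
    intro x hx
    have c1 := wronskian_const ha huv hvu hCd hCd' hx
    have c2 := wronskian_const ha huv hvu hCd hCd' haa
    have s1 := wronskian_const ha huv hvu hSd hCd hx
    have s2 := wronskian_const ha huv hvu hSd hCd haa
    rw [hua, hva] at c2 s2
    have hone := cosSol_sq_add μ (x + a)
    linear_combination (-u x) * hone - sinSol μ (x + a) * (c1 - c2)
      + cosSol μ (x + a) * (s1 - s2)
  apply hx0
  apply Lp.ext
  refine hu.2.trans (EventuallyEq.trans ?_ (Lp.coeFn_zero ℂ 2 (volume.restrict (Ioo (-a) a))).symm)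
  exact (ae_restrict_iff' measurableSet_Ioo).mpr
    (Eventually.of_forall fun x hx => hu0 x (Ioo_subset_Icc_self hx))

lemma isEigenvalue_iff {a : ℝ} (ha : 0 < a) {cm cp μ : ℂ} :
    IsEigenvalue (robin a cm cp) μ ↔ charFun (2 * a) cm cp μ = 0 :=
  ⟨charFun_eq_zero_of_isEigenvalue ha, fun h => ⟨_, robinMode_isEigenvector ha h⟩⟩

lemma mem_kerPow_succ {E : Type*} [AddCommGroup E] [Module ℂ E] {A : E →ₗ.[ℂ] E} {μ : ℂ} {k : ℕ}
    {x : A.domain} (h : A x - μ • (x : E) ∈ kerPow A μ k) : (x : E) ∈ kerPow A μ (k + 1) :=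
  Submodule.mem_map.mpr ⟨x, h, rfl⟩

/-- An eigenvector of a simple eigenvalue is not in the range of `A - μ`. -/
lemma IsSimpleEigenvalue.sub_ne {E : Type*} [AddCommGroup E] [Module ℂ E] {A : E →ₗ.[ℂ] E} {μ : ℂ}
    (hs : IsSimpleEigenvalue A μ) {x : E} (hx : IsEigenvector A μ x) (y : A.domain) :
    A y - μ • (y : E) ≠ x := by
  intro h
  obtain ⟨hx0, z, rfl, hz⟩ := hx
  have hz1 : (z : E) ∈ kerPow A μ 1 := mem_kerPow_succ (by rw [hz, sub_self]; exact zero_mem _)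
  have hy2 : (y : E) ∈ kerPow A μ 2 := mem_kerPow_succ (by rw [h]; exact hz1)
  have hle : ∀ k, kerPow A μ k ≤ ⨆ k, kerPow A μ k := le_iSup _
  -- The eigenvector and its preimage both lie in the one-dimensional generalized eigenspace, so the
  -- preimage is itself an eigenvector and A − μ kills it.
  have hone := (finrank_eq_one_iff_of_nonzero' (⟨z, hle 1 hz1⟩ : (⨆ k, kerPow A μ k : Submodule ℂ E))
    (fun h0 => hx0 (congrArg Subtype.val h0))).mp hs
  obtain ⟨c, hc⟩ := hone ⟨y, hle 2 hy2⟩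
  have hyz : y = c • z := Subtype.ext (congrArg Subtype.val hc).symm
  apply hx0
  rw [← h, hyz, A.map_smul, hz, Submodule.coe_smul, smul_comm, sub_self]

/-- Simplicity of an eigenvalue in terms of its eigenfunction `u`: `∫ u² ≠ 0`. -/
lemma integral_sq_ne_zero {a : ℝ} (ha : 0 < a) {cm cp μ : ℂ} (h : charFun (2 * a) cm cp μ = 0)
    (hs : IsSimpleEigenvalue (robin a cm cp) μ) :
    ∫ y in (0 : ℝ)..(2 * a), robinSol cm μ y ^ 2 ≠ 0 := by
  intro h0
  -- If ∫u² = 0, the eigenfunction satisfies the solvability condition for its own equation.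
  have e : ∫ x in (-a)..a, robinSol cm μ (x + a) * robinMode a cm μ x = 0 := by
    have e1 : ∫ x in (-a)..a, robinSol cm μ (x + a) * robinMode a cm μ x
        = ∫ x in (-a)..a, robinSol cm μ (x + a) ^ 2 := by
      rw [← integral_Ioo_eq_intervalIntegral ha, ← integral_Ioo_eq_intervalIntegral ha]
      refine integral_congr_ae ?_
      filter_upwards [coeFn_robinMode a cm μ] with x hx
      rw [hx, sq]
    rw [e1, intervalIntegral.integral_comp_add_right (fun y => robinSol cm μ y ^ 2),
      neg_add_cancel, ← two_mul, h0]
  obtain ⟨χ, hχ⟩ := exists_robin_sub_eq ha h e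
  exact hs.sub_ne (robinMode_isEigenvector ha h) χ hχ

lemma deriv_charFun_ne_zero_of_simple {a : ℝ} (ha : 0 < a) {cm cp : ℂ}
    (hs : ∀ μ : ℂ, IsEigenvalue (robin a cm cp) μ → IsSimpleEigenvalue (robin a cm cp) μ)
    {μ : ℂ} (h : charFun (2 * a) cm cp μ = 0) : deriv (charFun (2 * a) cm cp) μ ≠ 0 :=
  deriv_charFun_ne_zero h (integral_sq_ne_zero ha h (hs μ ((isEigenvalue_iff ha).mpr h)))

/-! ### Density of the domain and eigenvectors of the adjoint -/

/-- The Robin operator is densely defined. -/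
lemma dense_robinDomain {a : ℝ} (ha : 0 < a) (cm cp : ℂ) :
    Dense ((robin a cm cp).domain : Set (L2 a)) := by
  rw [Submodule.dense_iff_topologicalClosure_eq_top, Submodule.topologicalClosure_eq_top_iff,
    Submodule.eq_bot_iff]
  intro f hf
  have hfi : IntegrableOn f (Ioo (-a) a) := (Lp.memLp f).integrable (by norm_num)
  -- Test functions vanish at ±a with their derivatives, so they satisfy every Robin condition and
  -- lie in the domain.
  have key := (isOpen_Ioo (a := -a) (b := a)).ae_eq_zero_of_integral_contDiff_smul_eq_zero
    (f := f) (μ := volume) hfi.locallyIntegrableOn (by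
      intro η h1 h2 h3
      have hz : ∀ x, x ∉ Ioo (-a) a → η x = 0 := fun x hx =>
        image_eq_zero_of_notMem_tsupport fun hx' => hx (h3 hx')
      have hz' : ∀ x, x ∉ Ioo (-a) a → deriv η x = 0 := fun x hx =>
        image_eq_zero_of_notMem_tsupport fun hx' => hx (h3 (tsupport_deriv_subset hx'))
      have hd1 : ContDiff ℝ ∞ (deriv η) := (contDiff_infty_iff_deriv.mp h1).2
      have hd2 : ContDiff ℝ ∞ (deriv (deriv η)) := (contDiff_infty_iff_deriv.mp hd1).2
      have hc : ∀ κ : ℝ → ℝ, ContDiff ℝ ∞ κ → Continuous fun x => (κ x : ℂ) := fun κ hκ =>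
        Complex.continuous_ofReal.comp hκ.continuous
      have hd : ∀ κ : ℝ → ℝ, ContDiff ℝ ∞ κ → ∀ x, HasDerivAt (fun x => (κ x : ℂ))
          ((deriv κ x : ℝ) : ℂ) x := fun κ hκ x =>
        ((hκ.differentiable (by simp)) x).hasDerivAt.ofReal_comp
      have w1 : HasWeakDeriv a (toL2 (hc η h1).continuousOn) (toL2 (hc _ hd1).continuousOn) :=
        (isPrimitive_of_hasDerivAt (hd η h1) (hc _ hd1)).hasWeakDeriv ha (coeFn_toL2 _)
          (coeFn_toL2 _)
      have w2 : HasWeakDeriv a (toL2 (hc _ hd1).continuousOn) (toL2 (hc _ hd2).continuousOn) :=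
        (isPrimitive_of_hasDerivAt (hd _ hd1) (hc _ hd2)).hasWeakDeriv ha (coeFn_toL2 _)
          (coeFn_toL2 _)
      have hmem : toL2 (hc η h1).continuousOn ∈ robinDomain a cm cp := by
        refine ⟨_, _, ⟨w1, w2⟩, _, _, isContRep_toL2 _, isContRep_toL2 _, ?_, ?_⟩
        · rw [hz a (by simp), hz' a (by simp)]; simp
        · rw [hz (-a) (by simp), hz' (-a) (by simp)]; simp
      have horth := (Submodule.mem_orthogonal _ f).mp hf _ hmem
      rw [inner_toL2_left ha] at horth
      rw [← setIntegral_eq_integral_of_forall_compl_eq_zero (s := Ioo (-a) a)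
        (fun x hx => by rw [hz x hx, zero_smul]), integral_Ioo_eq_intervalIntegral ha, ← horth]
      simp)
  apply Lp.ext
  refine EventuallyEq.trans ?_ (Lp.coeFn_zero ℂ 2 (volume.restrict (Ioo (-a) a))).symm
  exact (ae_restrict_iff' measurableSet_Ioo).mpr key

lemma continuous_conj_robinSol_comp (c μ : ℂ) (a : ℝ) :
    Continuous fun x => conj (robinSol c μ (x + a)) :=
  Complex.continuous_conj.comp (continuous_robinSol_comp c μ a)

/-- Eigenvectors of the adjoint are multiples of the conjugate eigenfunction. -/
lemma exists_eq_smul_of_isEigenvector_adjoint {a : ℝ} (ha : 0 < a) {cm cp μ : ℂ}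
    (h : charFun (2 * a) cm cp μ = 0) {φ : L2 a}
    (hφ : IsEigenvector (robin a cm cp).adjoint (conj μ) φ) :
    ∃ k : ℂ, φ = k • toL2 (continuous_conj_robinSol_comp cm μ a).continuousOn := by
  set w : L2 a := toL2 (continuous_conj_robinSol_comp cm μ a).continuousOn with hw
  obtain ⟨-, y, rfl, hy⟩ := hφ
  -- Every g ⊥ w is (H − μ)χ for some χ, and ⟨y, (H − μ)χ⟩ = ⟨(H* − conj μ)y, χ⟩ = 0. So y lies in
  -- the double orthogonal complement of w, a line.
  have hmem : (y : L2 a) ∈ ((ℂ ∙ w)ᗮ)ᗮ := by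
    rw [Submodule.mem_orthogonal']
    intro g hg
    rw [Submodule.mem_orthogonal_singleton_iff_inner_right, hw, inner_toL2_left ha] at hg
    simp only [Complex.conj_conj] at hg
    obtain ⟨χ, hχ⟩ := exists_robin_sub_eq ha h hg
    have := LinearPMap.adjoint_isFormalAdjoint (dense_robinDomain ha cm cp) y χ
    rw [← hχ, inner_sub_right, ← this, hy, inner_smul_left, inner_smul_right, Complex.conj_conj,
      sub_self]
  rw [Submodule.orthogonal_orthogonal, Submodule.mem_span_singleton] at hmem
  obtain ⟨k, hk⟩ := hmem
  exact ⟨k, hk.symm⟩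

/-- The normalized eigenvectors of the adjoint. -/
lemma eq_smul_of_isEigenvector_adjoint {a : ℝ} (ha : 0 < a) {cm cp μ : ℂ}
    (h : charFun (2 * a) cm cp μ = 0) {φ : L2 a}
    (hφ : IsEigenvector (robin a cm cp).adjoint (conj μ) φ) {u : ℝ → ℂ} (hu : IsContRep a φ u) :
    φ = u (-a) • toL2 (continuous_conj_robinSol_comp cm μ a).continuousOn := by
  obtain ⟨k, hk⟩ := exists_eq_smul_of_isEigenvector_adjoint ha h hφ
  have hr := (isContRep_toL2 (a := a) (continuous_conj_robinSol_comp cm μ a).continuousOn).smul k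
  rw [← hk] at hr
  have := eqOn_Icc_of_ae_eq ha hu.1 hr.1 (hu.2.symm.trans hr.2)
    (left_mem_Icc.mpr (by linarith : -a ≤ a))
  rw [this, hk]
  simp

/-! ### Hilbert–Schmidt operators from square-summable families -/

/-- Square-summable families of vectors give Hilbert–Schmidt operators. -/
lemma exists_hilbertSchmidt_of_summable {E : Type*} [NormedAddCommGroup E] [InnerProductSpace ℂ E]
    (e : HilbertBasis ℕ ℂ E) {ψ : ℕ → E} (hψ : Summable fun n => ‖ψ n‖ ^ 2) :
    ∃ T : E →L[ℂ] E, (∀ f, HasSum (fun n => inner ℂ (ψ n) f • e n) (T f)) ∧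
      IsHilbertSchmidt T := by
  have hle : ∀ f n, ‖inner ℂ (ψ n) f‖ ^ 2 ≤ ‖ψ n‖ ^ 2 * ‖f‖ ^ 2 := fun f n => by
    rw [← mul_pow]
    exact pow_le_pow_left₀ (norm_nonneg _) (norm_inner_le_norm _ _) 2
  have hsum : ∀ f, Summable fun n => ‖inner ℂ (ψ n) f‖ ^ 2 := fun f =>
    Summable.of_nonneg_of_le (fun _ => sq_nonneg _) (hle f) (hψ.mul_right _)
  have htwo : (2 : ENNReal).toReal = ((2 : ℕ) : ℝ) := by simp
  have hmem : ∀ f, Memℓp (fun n => inner ℂ (ψ n) f) 2 := fun f => by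
    refine memℓp_gen ?_
    simpa only [htwo, Real.rpow_natCast] using hsum f
  let c : E →ₗ[ℂ] lp (fun _ : ℕ => ℂ) 2 :=
    { toFun := fun f => ⟨fun n => inner ℂ (ψ n) f, hmem f⟩
      map_add' := fun f g => by ext n; exact inner_add_right _ _ _
      map_smul' := fun r f => by ext n; exact inner_smul_right _ _ _ }
  have hnorm : ∀ f, ‖c f‖ ^ 2 = ∑' n, ‖inner ℂ (ψ n) f‖ ^ 2 := fun f => by
    have := lp.norm_rpow_eq_tsum (p := 2) (by simp) (c f)
    simp only [htwo, Real.rpow_natCast] at this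
    exact this
  have hbound : ∀ f, ‖c f‖ ≤ √(∑' n, ‖ψ n‖ ^ 2) * ‖f‖ := fun f => by
    refine le_of_sq_le_sq ?_ (by positivity)
    rw [hnorm, mul_pow, Real.sq_sqrt (tsum_nonneg fun _ => sq_nonneg _), ← tsum_mul_right]
    exact (hsum f).tsum_le_tsum (hle f) (hψ.mul_right _)
  let T : E →L[ℂ] E :=
    (e.repr.symm.toContinuousLinearEquiv : _ →L[ℂ] E).comp (c.mkContinuous _ hbound)
  have hT : ∀ f, T f = e.repr.symm (c f) := fun f => rfl
  refine ⟨T, fun f => ?_, fun {ι} b => ?_⟩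
  · rw [hT]; exact e.hasSum_repr_symm (c f)
  -- Parseval in b for each n, then exchange of the order of summation in a nonnegative double
  -- series.
  · have hpars : ∀ n, HasSum (fun i => ‖inner ℂ (ψ n) (b i)‖ ^ 2) (‖ψ n‖ ^ 2) := by
      intro n
      have h1 := b.hasSum_inner_mul_inner (ψ n) (ψ n)
      have h2 := RCLike.hasSum_re (𝕜 := ℂ) h1
      rw [← norm_sq_eq_re_inner] at h2
      refine h2.congr_fun fun i => ?_
      rw [← inner_conj_symm (b i), RCLike.mul_conj]
      norm_cast
    have hprod : Summable fun p : ℕ × ι => ‖inner ℂ (ψ p.1) (b p.2)‖ ^ 2 := by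
      rw [summable_prod_of_nonneg (fun _ => sq_nonneg _)]
      exact ⟨fun n => (hpars n).summable, by simpa only [(hpars _).tsum_eq] using hψ⟩
    have hsw := hprod.prod_symm.prod
    refine hsw.congr fun i => ?_
    rw [hT, LinearIsometryEquiv.norm_map, hnorm]
    rfl

/-! ### The Neumann basis and the unitary operator -/

lemma integral_cos_int_mul {d : ℝ} (hd : 0 < d) (k : ℤ) :
    ∫ y in (0 : ℝ)..d, Real.cos (k * Real.pi / d * y) = if k = 0 then d else 0 := by
  split_ifs with hk
  · simp [hk]
  · have hk' : (k : ℝ) * Real.pi / d ≠ 0 := by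
      have : (k : ℝ) ≠ 0 := by exact_mod_cast hk
      have := Real.pi_ne_zero
      positivity
    rw [intervalIntegral.integral_comp_mul_left (fun y => Real.cos y) hk', integral_cos,
      div_mul_cancel₀ _ hd.ne', Real.sin_int_mul_pi]
    simp

lemma integral_cos_mul_cos {d : ℝ} (hd : 0 < d) (m n : ℕ) :
    ∫ y in (0 : ℝ)..d, Real.cos (m * Real.pi / d * y) * Real.cos (n * Real.pi / d * y)
      = if m = n then (if n = 0 then d else d / 2) else 0 := by
  have e : ∀ y : ℝ, Real.cos (m * Real.pi / d * y) * Real.cos (n * Real.pi / d * y)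
      = 1 / 2 * Real.cos (((m - n : ℤ) : ℝ) * Real.pi / d * y)
        + 1 / 2 * Real.cos (((m + n : ℤ) : ℝ) * Real.pi / d * y) := by
    intro y
    have h1 := Real.cos_sub (m * Real.pi / d * y) (n * Real.pi / d * y)
    have h2 := Real.cos_add (m * Real.pi / d * y) (n * Real.pi / d * y)
    have e1 : ((m - n : ℤ) : ℝ) * Real.pi / d * y = m * Real.pi / d * y - n * Real.pi / d * y := by
      push_cast; ring
    have e2 : ((m + n : ℤ) : ℝ) * Real.pi / d * y = m * Real.pi / d * y + n * Real.pi / d * y := by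
      push_cast; ring
    rw [e1, e2, h1, h2]; ring
  simp only [e]
  rw [intervalIntegral.integral_add (by apply Continuous.intervalIntegrable; fun_prop)
    (by apply Continuous.intervalIntegrable; fun_prop), intervalIntegral.integral_const_mul,
    intervalIntegral.integral_const_mul, integral_cos_int_mul hd, integral_cos_int_mul hd]
  have c1 : ((m : ℤ) - n = 0) ↔ m = n := by omega
  have c2 : ((m : ℤ) + n = 0) ↔ m = 0 ∧ n = 0 := by omega
  simp only [c1, c2]
  split_ifs with h1 h2 h3 h4 h5 <;> first | (exfalso; omega) | ring

/-- The normalization constants of the Neumann eigenfunctions. -/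
def neumannConst (a : ℝ) (n : ℕ) : ℝ := if n = 0 then 1 / √(2 * a) else 1 / √a

lemma neumannFun_eq (a : ℝ) (n : ℕ) (x : ℝ) :
    neumannFun a n x
      = ((neumannConst a n * Real.cos (n * Real.pi / (2 * a) * (x + a)) : ℝ) : ℂ) := by
  unfold neumannFun neumannConst
  split_ifs with h
  · simp [h]
  · rfl

lemma coeFn_neumannMode (a : ℝ) (n : ℕ) :
    neumannMode a n =ᵐ[volume.restrict (Ioo (-a) a)] neumannFun a n :=
  (memLp_neumannFun a n).coeFn_toLp

lemma inner_neumannMode_left {a : ℝ} (ha : 0 < a) (n : ℕ) (f : L2 a) :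
    inner ℂ (neumannMode a n) f = (neumannConst a n : ℂ) *
      ∫ x in (-a)..a, ((Real.cos (n * Real.pi / (2 * a) * (x + a)) : ℝ) : ℂ) * f x := by
  rw [inner_eq_intervalIntegral ha, ← integral_Ioo_eq_intervalIntegral ha,
    ← integral_Ioo_eq_intervalIntegral ha, ← integral_const_mul]
  refine integral_congr_ae ?_
  filter_upwards [coeFn_neumannMode a n] with x hx
  rw [hx, neumannFun_eq, Complex.conj_ofReal, Complex.ofReal_mul, mul_assoc]

lemma orthonormal_neumannMode {a : ℝ} (ha : 0 < a) : Orthonormal ℂ (neumannMode a) := by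
  rw [orthonormal_iff_ite]
  intro m n
  have e : ∫ x in (-a)..a, ((Real.cos (m * Real.pi / (2 * a) * (x + a)) : ℝ) : ℂ) * neumannMode a n x
      = ((neumannConst a n * ∫ x in (-a)..a, Real.cos (m * Real.pi / (2 * a) * (x + a))
          * Real.cos (n * Real.pi / (2 * a) * (x + a)) : ℝ) : ℂ) := by
    rw [← intervalIntegral.integral_const_mul, ← intervalIntegral.integral_ofReal,
      ← integral_Ioo_eq_intervalIntegral ha, ← integral_Ioo_eq_intervalIntegral ha]
    refine integral_congr_ae ?_
    filter_upwards [coeFn_neumannMode a n] with x hx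
    rw [hx, neumannFun_eq]; push_cast; ring
  rw [inner_neumannMode_left ha, e, intervalIntegral.integral_comp_add_right
    (fun y => Real.cos (m * Real.pi / (2 * a) * y) * Real.cos (n * Real.pi / (2 * a) * y)),
    neg_add_cancel, ← two_mul, integral_cos_mul_cos (by linarith : (0 : ℝ) < 2 * a)]
  have ha0 : √a ≠ 0 := (Real.sqrt_pos.mpr ha).ne'
  have hsa : √a ^ 2 = a := Real.sq_sqrt ha.le
  have ha2 : √(2 * a) ≠ 0 := (Real.sqrt_pos.mpr (by linarith)).ne'
  have hsa2 : √(2 * a) ^ 2 = 2 * a := Real.sq_sqrt (by linarith)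
  rw [← Complex.ofReal_mul]
  by_cases hmn : m = n
  · subst hmn
    simp only [if_true]
    norm_cast
    unfold neumannConst
    split_ifs with h
    · field_simp; exact hsa2.symm
    · field_simp; exact hsa.symm
  · simp [hmn]

/-- A function orthogonal to all cosines `cos (nπ(x+a)/(2a))` is orthogonal to all continuous
functions. -/
lemma integral_mul_eq_zero_of_cos {a : ℝ} (ha : 0 < a) (f : L2 a)
    (hf : ∀ n : ℕ, ∫ x in (-a)..a,
      ((Real.cos (n * Real.pi / (2 * a) * (x + a)) : ℝ) : ℂ) * f x = 0)
    {η : ℝ → ℝ} (hη : Continuous η) : ∫ x in (-a)..a, (η x : ℂ) * f x = 0 := by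
  have hfi := intervalIntegrable_L2 ha f
  have hI : ∀ κ : ℝ → ℝ, Continuous κ →
      IntervalIntegrable (fun x => (κ x : ℂ) * f x) volume (-a) a := fun κ hκ =>
    hfi.continuousOn_mul (Complex.continuous_ofReal.comp hκ).continuousOn
  set α : ℝ → ℝ := fun x => Real.pi / (2 * a) * (x + a) with hα
  have hαc : Continuous α := by fun_prop
  -- Integer frequencies, because the induction below shifts k by ±1 through the product-to-sum
  -- formula.
  have hcos : ∀ k : ℤ, ∫ x in (-a)..a, ((Real.cos (k * α x) : ℝ) : ℂ) * f x = 0 := by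
    have hnat : ∀ n : ℕ, ∫ x in (-a)..a, ((Real.cos (n * α x) : ℝ) : ℂ) * f x = 0 := by
      intro n
      rw [← hf n]
      refine intervalIntegral.integral_congr fun x _ => ?_
      simp only [hα]
      congr 3; ring
    intro k
    obtain ⟨n, rfl | rfl⟩ := k.eq_nat_or_neg
    · exact_mod_cast hnat n
    · rw [← hnat n]
      refine intervalIntegral.integral_congr fun x _ => ?_
      simp only [Int.cast_neg, Int.cast_natCast, neg_mul, Real.cos_neg]
  have hpow : ∀ (j : ℕ) (k : ℤ),
      ∫ x in (-a)..a, ((Real.cos (α x) ^ j * Real.cos (k * α x) : ℝ) : ℂ) * f x = 0 := by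
    intro j
    induction j with
    | zero => intro k; simpa using hcos k
    | succ j ih =>
      intro k
      have e : ∀ x, ((Real.cos (α x) ^ (j + 1) * Real.cos (k * α x) : ℝ) : ℂ) * f x
          = 1 / 2 * (((Real.cos (α x) ^ j * Real.cos ((k + 1 : ℤ) * α x) : ℝ) : ℂ) * f x)
            + 1 / 2 * (((Real.cos (α x) ^ j * Real.cos ((k - 1 : ℤ) * α x) : ℝ) : ℂ) * f x) := by
        intro x
        have h1 := Real.cos_add (k * α x) (α x)
        have h2 := Real.cos_sub (k * α x) (α x)
        have e1 : ((k + 1 : ℤ) : ℝ) * α x = k * α x + α x := by push_cast; ring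
        have e2 : ((k - 1 : ℤ) : ℝ) * α x = k * α x - α x := by push_cast; ring
        rw [e1, e2, h1, h2]
        push_cast
        ring
      simp only [e]
      rw [intervalIntegral.integral_add ((hI _ (by fun_prop)).const_mul _)
        ((hI _ (by fun_prop)).const_mul _), intervalIntegral.integral_const_mul,
        intervalIntegral.integral_const_mul, ih, ih]
      simp
  have hpoly : ∀ p : Polynomial ℝ,
      ∫ x in (-a)..a, ((p.eval (Real.cos (α x)) : ℝ) : ℂ) * f x = 0 := by
    intro p
    induction p using Polynomial.induction_on' with
    | add p q hp hq =>
      have hpc : Continuous fun x => p.eval (Real.cos (α x)) := p.continuous.comp (by fun_prop)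
      have hqc : Continuous fun x => q.eval (Real.cos (α x)) := q.continuous.comp (by fun_prop)
      simp only [Polynomial.eval_add, Complex.ofReal_add, add_mul]
      rw [intervalIntegral.integral_add (hI _ hpc) (hI _ hqc), hp, hq, add_zero]
    | monomial j c =>
      have := hpow j 0
      simp only [Int.cast_zero, zero_mul, Real.cos_zero, mul_one] at this
      simp only [Polynomial.eval_monomial, Complex.ofReal_mul, mul_assoc]
      rw [intervalIntegral.integral_const_mul, this, mul_zero]
  -- On [−a, a] the map x ↦ cos(α x) is injective, so η is a continuous function h of it, and
  -- Weierstrass approximates h by polynomials on [−1, 1].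
  set h : ℝ → ℝ := fun s => η (Real.arccos s * (2 * a) / Real.pi - a) with hh
  have hhc : Continuous h := by
    have := Real.continuous_arccos
    fun_prop
  have hht : ∀ x ∈ Icc (-a) a, h (Real.cos (α x)) = η x := by
    intro x hx
    have h0 : 0 ≤ α x := mul_nonneg (by positivity) (by linarith [hx.1])
    have h1 : α x ≤ Real.pi := by
      simp only [hα]
      rw [div_mul_eq_mul_div, div_le_iff₀ (by linarith)]
      nlinarith [Real.pi_pos, hx.2]
    simp only [hh]
    rw [Real.arccos_cos h0 h1]
    congr 1
    simp only [hα]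
    field_simp
    ring
  rw [← norm_le_zero_iff]
  refine le_of_forall_pos_le_add fun ε hε => ?_
  set M := ∫ x in (-a)..a, ‖f x‖ with hM
  have hM0 : 0 ≤ M := intervalIntegral.integral_nonneg (by linarith) fun _ _ => norm_nonneg _
  obtain ⟨p, hp⟩ := exists_polynomial_near_of_continuousOn (-1) 1 h hhc.continuousOn
    (ε / (M + 1)) (by positivity)
  have hpc : Continuous fun x => p.eval (Real.cos (α x)) := p.continuous.comp (by fun_prop)
  have e : ∫ x in (-a)..a, (η x : ℂ) * f x
      = ∫ x in (-a)..a, ((η x - p.eval (Real.cos (α x)) : ℝ) : ℂ) * f x := by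
    simp only [Complex.ofReal_sub, sub_mul]
    rw [intervalIntegral.integral_sub (hI η hη) (hI _ hpc), hpoly p, sub_zero]
  rw [e, zero_add]
  calc ‖∫ x in (-a)..a, ((η x - p.eval (Real.cos (α x)) : ℝ) : ℂ) * f x‖
      ≤ ∫ x in (-a)..a, ε / (M + 1) * ‖f x‖ := by
        refine intervalIntegral.norm_integral_le_of_norm_le (by linarith)
          (Eventually.of_forall fun x hx => ?_) (hfi.norm.const_mul _)
        have hx' : x ∈ Icc (-a) a := Ioc_subset_Icc_self hx
        rw [norm_mul, Complex.norm_real, Real.norm_eq_abs, ← hht x hx', abs_sub_comm]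
        exact mul_le_mul_of_nonneg_right
          (hp _ ⟨Real.neg_one_le_cos _, Real.cos_le_one _⟩).le (norm_nonneg _)
    _ = ε / (M + 1) * M := by rw [intervalIntegral.integral_const_mul]
    _ ≤ ε := by
        rw [div_mul_eq_mul_div, div_le_iff₀ (by positivity)]
        nlinarith

lemma orthogonal_span_neumannMode {a : ℝ} (ha : 0 < a) :
    (Submodule.span ℂ (range (neumannMode a)))ᗮ = ⊥ := by
  rw [Submodule.eq_bot_iff]
  intro f hf
  have hcos : ∀ n : ℕ, ∫ x in (-a)..a,
      ((Real.cos (n * Real.pi / (2 * a) * (x + a)) : ℝ) : ℂ) * f x = 0 := by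
    intro n
    have h1 := (Submodule.mem_orthogonal _ f).mp hf _
      (Submodule.subset_span (mem_range_self n))
    rw [inner_neumannMode_left ha, mul_eq_zero, Complex.ofReal_eq_zero] at h1
    refine h1.resolve_left ?_
    have := Real.sqrt_pos.mpr ha
    have := Real.sqrt_pos.mpr (by linarith : 0 < 2 * a)
    unfold neumannConst
    split_ifs <;> positivity
  have hfi : IntegrableOn f (Ioo (-a) a) := (Lp.memLp f).integrable (by norm_num)
  have key := (isOpen_Ioo (a := -a) (b := a)).ae_eq_zero_of_integral_contDiff_smul_eq_zero
    (f := f) (μ := volume) hfi.locallyIntegrableOn (by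
      intro η h1 h2 h3
      have hz : ∀ x, x ∉ Ioo (-a) a → η x = 0 := fun x hx =>
        image_eq_zero_of_notMem_tsupport fun hx' => hx (h3 hx')
      rw [← setIntegral_eq_integral_of_forall_compl_eq_zero (s := Ioo (-a) a)
        (fun x hx => by rw [hz x hx, zero_smul]), integral_Ioo_eq_intervalIntegral ha,
        ← integral_mul_eq_zero_of_cos ha f hcos h1.continuous]
      simp only [Complex.real_smul])
  apply Lp.ext
  refine EventuallyEq.trans ?_ (Lp.coeFn_zero ℂ 2 (volume.restrict (Ioo (-a) a))).symm
  exact (ae_restrict_iff' measurableSet_Ioo).mpr key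

/-- The Neumann eigenfunctions form an orthonormal basis. -/
def neumannBasis {a : ℝ} (ha : 0 < a) : HilbertBasis ℕ ℂ (L2 a) :=
  HilbertBasis.mkOfOrthogonalEqBot (orthonormal_neumannMode ha) (orthogonal_span_neumannMode ha)

lemma coe_neumannBasis {a : ℝ} (ha : 0 < a) : ⇑(neumannBasis ha) = neumannMode a :=
  HilbertBasis.coe_mkOfOrthogonalEqBot _ _

/-- The unitary operator that maps one orthonormal basis to another. -/
lemma exists_unitary_of_hilbertBasis {E : Type*} [NormedAddCommGroup E] [InnerProductSpace ℂ E]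
    [CompleteSpace E] (b e : HilbertBasis ℕ ℂ E) :
    ∃ U : E →L[ℂ] E, (∀ f, HasSum (fun n => inner ℂ (b n) f • e n) (U f)) ∧
      (∀ n, U (b n) = e n) ∧ U ∈ unitary (E →L[ℂ] E) := by
  refine ⟨(Unitary.linearIsometryEquiv.symm (b.repr.trans e.repr.symm) : unitary (E →L[ℂ] E)).1,
    fun f => ?_, fun n => ?_, Subtype.property _⟩
  · have := e.hasSum_repr_symm (b.repr f)
    simp only [b.repr_apply_apply] at this
    exact this
  · have : e.repr.symm (b.repr (b n)) = e n := by
      classical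
      rw [b.repr_self, e.repr_symm_single]
    exact this

/-! ### Square-summable closeness and conclusion -/

/-- The normalized eigenfunctions of the adjoint are square-summably close to the Neumann
eigenfunctions. -/
lemma summable_norm_sub_sq {a : ℝ} (ha : 0 < a) {cm cp : ℂ} {lam : ℕ → ℂ}
    (hz : ∀ n, charFun (2 * a) cm cp (lam n) = 0)
    (hb : ∃ M : ℕ, ∀ n ≥ M, sepRadius (2 * a) n ^ 2 ≤ ‖lam (n + 1)‖ ∧
      ‖lam (n + 1)‖ < sepRadius (2 * a) (n + 1) ^ 2)
    {φ : ℕ → L2 a} (hφ : ∃ N : ℕ, ∀ n ≥ N, φ n = ((1 / √a : ℝ) : ℂ) •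
      toL2 (continuous_conj_robinSol_comp cm (lam n) a).continuousOn) :
    Summable fun n => ‖φ n - neumannMode a n‖ ^ 2 := by
  obtain ⟨K, hK, M, hM⟩ := robinSol_asymptotic (by linarith : (0 : ℝ) < 2 * a) hz hb
  obtain ⟨N, hN⟩ := hφ
  -- The square root of the measure of (−a, a), which converts a uniform bound into an L² bound.
  set m : ℝ := (measureUnivNNReal (volume.restrict (Ioo (-a) a)) : ℝ) ^ (2 : ENNReal).toReal⁻¹ with hm
  have hm0 : 0 ≤ m := by positivity
  set B : ℝ := m * (1 / √a * K) with hB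
  -- The index 0 is excluded because χ_0^N has the different constant 1/√(2a).
  have hle : ∀ n ≥ max (max M N) 1, ‖φ n - neumannMode a n‖ ≤ B / n := by
    intro n hn
    have hn1 : n ≠ 0 := by have := le_of_max_le_right hn; omega
    have h1 := hM n (le_of_max_le_left (le_of_max_le_left hn))
    have h2 := hN n (le_of_max_le_right (le_of_max_le_left hn))
    have := Lp.norm_le_of_ae_bound (f := φ n - neumannMode a n) (C := 1 / √a * (K / n))
      (by positivity) (by
        have hae : ∀ᵐ x ∂(volume.restrict (Ioo (-a) a)), x ∈ Ioo (-a) a :=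
          ae_restrict_mem measurableSet_Ioo
        rw [h2]
        filter_upwards [hae, Lp.coeFn_sub (((1 / √a : ℝ) : ℂ) •
            toL2 (a := a) (continuous_conj_robinSol_comp cm (lam n) a).continuousOn)
            (neumannMode a n), Lp.coeFn_smul ((1 / √a : ℝ) : ℂ)
            (toL2 (a := a) (continuous_conj_robinSol_comp cm (lam n) a).continuousOn),
          coeFn_toL2 (a := a) (continuous_conj_robinSol_comp cm (lam n) a).continuousOn,
          coeFn_neumannMode a n] with x hx e1 e2 e3 e4
        rw [e1, Pi.sub_apply, e2, Pi.smul_apply, e3, e4, neumannFun_eq, neumannConst, if_neg hn1,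
          smul_eq_mul, Complex.ofReal_mul, ← mul_sub, norm_mul, Complex.norm_real,
          Real.norm_of_nonneg (by positivity : (0 : ℝ) ≤ 1 / √a)]
        refine mul_le_mul_of_nonneg_left ?_ (by positivity)
        rw [← Complex.conj_ofReal (Real.cos _), ← map_sub, RCLike.norm_conj]
        exact h1 (x + a) ⟨by linarith [hx.1], by linarith [hx.2]⟩)
    refine this.trans (le_of_eq ?_)
    rw [hB, hm]
    ring
  refine Summable.of_norm_bounded_eventually_nat (g := fun n : ℕ => B ^ 2 * (1 / (n : ℝ) ^ 2))
    ((Real.summable_one_div_nat_pow.mpr (by norm_num)).mul_left _) ?_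
  filter_upwards [eventually_ge_atTop (max (max M N) 1)] with n hn
  rw [Real.norm_of_nonneg (sq_nonneg _)]
  calc _ ≤ (B / n) ^ 2 := pow_le_pow_left₀ (norm_nonneg _) (hle n hn) 2
    _ = _ := by ring

end RobinInterval

end

theorem theorem3p2 (a : ℝ) (ha : 0 < a) (cm cp : ℂ)
    -- all eigenvalues of the Robin operator are simple
    (hsimple : ∀ μ : ℂ, RobinInterval.IsEigenvalue (RobinInterval.robin a cm cp) μ →
      RobinInterval.IsSimpleEigenvalue (RobinInterval.robin a cm cp) μ)
    -- enumeration of the eigenvalues, with nondecreasing modulus from some index on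
    (lam : ℕ → ℂ) (hinj : Function.Injective lam)
    (hrange : Set.range lam = {μ | RobinInterval.IsEigenvalue (RobinInterval.robin a cm cp) μ})
    (hord : ∃ N : ℕ, ∀ m n : ℕ, N ≤ m → m ≤ n → ‖lam m‖ ≤ ‖lam n‖)
    -- eigenfunctions of the adjoint, with `φ_n(-a) = 1/√a` for all but finitely many `n`
    (φ : ℕ → RobinInterval.L2 a)
    (hφ : ∀ n, RobinInterval.IsEigenvector (RobinInterval.robin a cm cp).adjoint
      (conj (lam n)) (φ n))
    (hnorm : ∃ N : ℕ, ∀ n : ℕ, N ≤ n → ∃ u : ℝ → ℂ,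
      RobinInterval.IsContRep a (φ n) u ∧ u (-a) = ((1 / √a : ℝ) : ℂ))
    (e : HilbertBasis ℕ ℂ (RobinInterval.L2 a)) :
    ∃ Ω U L : RobinInterval.L2 a →L[ℂ] RobinInterval.L2 a,
      (∀ f, HasSum (fun n => inner ℂ (φ n) f • e n) (Ω f)) ∧
      (∀ f, HasSum (fun n => inner ℂ (RobinInterval.neumannMode a n) f • e n) (U f)) ∧
      (∀ n, U (RobinInterval.neumannMode a n) = e n) ∧
      U ∈ unitary (RobinInterval.L2 a →L[ℂ] RobinInterval.L2 a) ∧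
      RobinInterval.IsHilbertSchmidt L ∧
      Ω = U + L := by
  have hz : ∀ n, RobinInterval.charFun (2 * a) cm cp (lam n) = 0 := fun n =>
    (RobinInterval.isEigenvalue_iff ha).mp (hrange.subset (mem_range_self n))
  have hZ : range lam = {μ | RobinInterval.charFun (2 * a) cm cp μ = 0} := by
    rw [hrange]
    ext μ
    exact RobinInterval.isEigenvalue_iff ha
  have h2a : 0 < 2 * a := by linarith
  have hb : ∃ M : ℕ, ∀ n ≥ M, RobinInterval.sepRadius (2 * a) n ^ 2 ≤ ‖lam (n + 1)‖ ∧
      ‖lam (n + 1)‖ < RobinInterval.sepRadius (2 * a) (n + 1) ^ 2 :=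
    RobinInterval.norm_enumeration_mem
      ((tendsto_pow_atTop two_ne_zero).comp (RobinInterval.tendsto_sepRadius h2a))
      (RobinInterval.ncard_zeros_charFun h2a cm cp fun μ hμ => RobinInterval.deriv_charFun_ne_zero_of_simple ha hsimple hμ)
      hinj hZ hord
  have hφ' : ∃ N : ℕ, ∀ n ≥ N, φ n = ((1 / √a : ℝ) : ℂ) •
      RobinInterval.toL2 (RobinInterval.continuous_conj_robinSol_comp cm (lam n) a).continuousOn := by
    obtain ⟨N, hN⟩ := hnorm
    refine ⟨N, fun n hn => ?_⟩
    obtain ⟨u, hu, hua⟩ := hN n hn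
    rw [← hua]
    exact RobinInterval.eq_smul_of_isEigenvector_adjoint ha (hz n) (hφ n) hu
  -- L is built from the differences φ_n − χ_n^N, so the series of U and L add up to that of Ω.
  obtain ⟨L, hL, hLHS⟩ := RobinInterval.exists_hilbertSchmidt_of_summable e (RobinInterval.summable_norm_sub_sq ha hz hb hφ')
  obtain ⟨U, hU, hUe, hUu⟩ := RobinInterval.exists_unitary_of_hilbertBasis (RobinInterval.neumannBasis ha) e
  simp only [RobinInterval.coe_neumannBasis] at hU hUe
  refine ⟨U + L, U, L, fun f => ?_, hU, hUe, hUu, hLHS, rfl⟩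
  refine ((hU f).add (hL f)).congr_fun fun n => ?_
  rw [inner_sub_left, ← add_smul, add_sub_cancel]
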